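/- Let $n\ge 2$ be an integer. For $a\in\mathbb{R}^n$ the radial projection based at $a$ is $P_a(x)=\frac{x-a}{|x-a|}$, $x\ne a$, and for $F\subseteq\mathbb{R}^n$ the visibility of $F$ from $a$ is $\operatorname{vis}(a,F)=\mathcal{H}^{n-1}\big(P_a(F\setminus\{a\})\big)$. Let $E(r)$ denote the (open) $r$-neighborhood of $E$. A *piecewise smooth $(n-1)$-dimensional surface* in $\mathbb{R}^n$ is a finite union of patches $\varphi(D)$, where $D\subset\mathbb{R}^{n-1}$ is a nonempty compact set which is the closure of its interior, and $\varphi$ is $C^1$ on a neighborhood of $D$ with values in $\mathbb{R}^n$, one-to-one on $D$, with injective derivative at every point of $D$. The tangent plane of $A$ based at $a\in A$ is the affine subspace through $a$ whose direction is spanned by the tangent cone of $A$ at $a$ (the limits of rescaled secants $c_k(a_k-a)$ with $a_k\in A$, $a_k\to a$, $c_k\in\mathbb{R}$); at $\mathcal{H}^{n-1}$-almost every point of a piecewise smooth surface it is the usual tangent plane. A *family of projection-type operators* into an $m$-dimensional target ($1\le m<n$ an integer) consists of: a domain $\Omega\subseteq\mathbb{R}^n$; a subset $X$ of a Euclidean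 space with a Borel measure $h$ on $X$ such that, for some $c>0$, $h(B(x,\delta))\ge c\,\delta^m$ for all $x\in X$ and $\delta\in(0,1)$; an index set $A$ in a Euclidean space with a probability measure $\psi$ with compact support in $A$; and maps $\pi_\alpha:\Omega\to X$ ($\alpha\in A$) such that $(x,\alpha)\mapsto\pi_\alpha(x)$ is continuous. Such a family is *$t$-transversal* if there are constants $c>0$ and $\delta_0>0$ such that for all distinct $x,y\in\Omega$ and all $0<\delta\le\delta_0$ $$\psi\{\alpha\in A:|\pi_\alpha(x)-\pi_\alpha(y)|\le\delta|x-y|\}<c\,\delta^m|x-y|^{m-t}.$$ **Theorem 1.7 (Visibility for surfaces in $\mathbb{R}^n$).** Let $s\ge 0$, let $E\subseteq\mathbb{R}^n$ satisfy $0<\mathcal{H}^s(E)<\infty$, and let $A\subset\mathbb{R}^n$ be a nonempty piecewise smooth $(n-1)$-dimensional surface. Assume that there is $R<\infty$ with $|a-e|\le R$ for all $a\in A$, $e\in E$, and that there is $\rho>0$ such that for $\mathcal{H}^{n-1}$-almost every $a\in A$ every point of the tangent plane of $A$ based at $a$ has distance at least $\rho$ from every point of $E$. Then: 1. The family of radial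 projections $\{P_a:a\in A\}$, with domain $\Omega=E$, target $X=S^{n-1}$ carrying $h=\mathcal{H}^{n-1}$ (so $m=n-1$), and index measure $\psi=\mathcal{H}^{n-1}|_A/\mathcal{H}^{n-1}(A)$, is a family of projection-type operators and is $(n-1)$-transversal. 2. If $s<n-1$, there is a constant $c>0$ such that for all $0<r<1$ $$\int_A\operatorname{vis}(a,E(r))\,d\mathcal{H}^{n-1}(a)\ \ge\ c\,r^{\,n-1-s}.$$ 3. If $s=n-1$, there is a constant $c>0$ such that for all $0<r\le\tfrac12$ $$\int_A\operatorname{vis}(a,E(r))\,d\mathcal{H}^{n-1}(a)\ \ge\ c\,\Big(\log\frac1r\Big)^{-1}.$$ -/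

import Mathlib

open MeasureTheory Set

/-- `S` is a regular compact `m`-dimensional patch of class `C¹` in `ℝⁿ`: the image of a nonempty
compact domain `D ⊆ ℝᵐ` (a compact set that is the closure of its interior) under a map which is
`C¹` on a neighbourhood of `D`, one-to-one on `D`, and has injective derivative at every
point of `D`. -/
def IsSmoothPatch {n : ℕ} (m : ℕ) (S : Set (EuclideanSpace ℝ (Fin n))) : Prop :=
  ∃ (D U : Set (EuclideanSpace ℝ (Fin m)))
    (φ : EuclideanSpace ℝ (Fin m) → EuclideanSpace ℝ (Fin n)),
    D.Nonempty ∧ IsCompact D ∧ closure (interior D) = D ∧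
    IsOpen U ∧ D ⊆ U ∧ ContDiffOn ℝ 1 φ U ∧ InjOn φ D ∧
    (∀ u ∈ D, Function.Injective (fderiv ℝ φ u)) ∧
    φ '' D = S

/-- A piecewise smooth `m`-dimensional surface in `ℝⁿ`: a union of finitely many patches
(no condition is imposed on how the patches meet). -/
def IsPiecewiseSmoothSurface {n : ℕ} (m : ℕ) (A : Set (EuclideanSpace ℝ (Fin n))) : Prop :=
  ∃ (k : ℕ) (S : Fin k → Set (EuclideanSpace ℝ (Fin n))),
    (∀ i, IsSmoothPatch m (S i)) ∧ A = ⋃ i, S i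

/-- The affine tangent plane of `A` based at `a`: the affine subspace through `a` whose direction
is spanned by all limits of rescaled secants of `A` at `a`. At almost every point of a
piecewise smooth surface (in particular at all points inside a patch that lie on no other patch)
this is the usual tangent plane. -/
noncomputable def tangentPlaneAt {n : ℕ} (A : Set (EuclideanSpace ℝ (Fin n))) (a : EuclideanSpace ℝ (Fin n)) :
    AffineSubspace ℝ (EuclideanSpace ℝ (Fin n)) :=
  AffineSubspace.mk' a (Submodule.span ℝ (tangentConeAt ℝ A a))

/-- The radial projection `P_a(x) = (x - a) / |x - a|` (meaningful for `x ≠ a`). -/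
noncomputable def radialProj {n : ℕ} (a x : EuclideanSpace ℝ (Fin n)) :
    EuclideanSpace ℝ (Fin n) :=
  ‖x - a‖⁻¹ • (x - a)

/-- The visibility of `E` from `a`: the `(n-1)`-dimensional Hausdorff measure of the radial
projection of `E` (minus the point `a`, where the projection is undefined) to the unit sphere. -/
noncomputable def vis {n : ℕ} (a : EuclideanSpace ℝ (Fin n))
    (E : Set (EuclideanSpace ℝ (Fin n))) : ENNReal :=
  μH[(n : ℝ) - 1] (radialProj a '' (E \ {a}))

/-- A family of projection-type operators `π α : Ω → X`, `α ∈ A`. The measure `h` on the codomain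
and the probability measure `ψ` on the index set are represented as Borel measures on the ambient
Euclidean spaces. -/
structure IsProjectionFamily {n p q : ℕ} (m : ℕ)
    (Ω : Set (EuclideanSpace ℝ (Fin n)))
    (X : Set (EuclideanSpace ℝ (Fin p))) (h : Measure (EuclideanSpace ℝ (Fin p)))
    (A : Set (EuclideanSpace ℝ (Fin q))) (ψ : Measure (EuclideanSpace ℝ (Fin q)))
    (π : EuclideanSpace ℝ (Fin q) → EuclideanSpace ℝ (Fin n) → EuclideanSpace ℝ (Fin p)) :
    Prop where
  one_le : 1 ≤ m
  lt_dim : m < n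
  codomain_supp : h Xᶜ = 0
  codomain_lower : ∃ c : ℝ, 0 < c ∧ ∀ x ∈ X, ∀ δ : ℝ, 0 < δ → δ < 1 →
    ENNReal.ofReal (c * δ ^ m) ≤ h (Metric.ball x δ ∩ X)
  index_prob : IsProbabilityMeasure ψ
  index_supp : ∃ K : Set (EuclideanSpace ℝ (Fin q)), IsCompact K ∧ K ⊆ A ∧ ψ Kᶜ = 0
  maps_to : ∀ α ∈ A, MapsTo (π α) Ω X
  cont : ContinuousOn
    (fun z : EuclideanSpace ℝ (Fin n) × EuclideanSpace ℝ (Fin q) => π z.2 z.1) (Ω ×ˢ A)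

/-- `s`-transversality of a family of projection-type operators into an `m`-dimensional target. -/
def IsTransversal {n p q : ℕ} (s : ℝ) (m : ℕ)
    (Ω : Set (EuclideanSpace ℝ (Fin n)))
    (X : Set (EuclideanSpace ℝ (Fin p))) (h : Measure (EuclideanSpace ℝ (Fin p)))
    (A : Set (EuclideanSpace ℝ (Fin q))) (ψ : Measure (EuclideanSpace ℝ (Fin q)))
    (π : EuclideanSpace ℝ (Fin q) → EuclideanSpace ℝ (Fin n) → EuclideanSpace ℝ (Fin p)) :
    Prop :=
  IsProjectionFamily m Ω X h A ψ π ∧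
  ∃ c δ₀ : ℝ, 0 < c ∧ 0 < δ₀ ∧
    ∀ x ∈ Ω, ∀ y ∈ Ω, x ≠ y → ∀ δ : ℝ, 0 < δ → δ ≤ δ₀ →
      ψ {α | α ∈ A ∧ ‖π α x - π α y‖ ≤ δ * ‖x - y‖} <
        ENNReal.ofReal (c * δ ^ m * ‖x - y‖ ^ ((m : ℝ) - s))

/-- Normalised `(n-1)`-dimensional Hausdorff measure on a subset `A` of `ℝⁿ`. -/
noncomputable def normalizedSurfaceMeasure {n : ℕ} (A : Set (EuclideanSpace ℝ (Fin n))) :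
    Measure (EuclideanSpace ℝ (Fin n)) :=
  (μH[(n : ℝ) - 1] A)⁻¹ • (μH[(n : ℝ) - 1]).restrict A

/-!
Write `m = n - 1`. The transversality of the radial projections is a statement about one patch at a
time. If `P_a x` and `P_a y` differ by at most `δ |x - y|` with `δ` small, then `a` lies within
`O(δ)` of the line through `x` and `y`, and `x - y` is almost parallel to `y - a`. The hypothesis
on tangent planes, which by continuity holds at *every* point of every patch and for every point of
`closure E`, keeps `y` at distance `ρ` from the tangent plane at `a`, so this line is uniformly
transversal to the surface (`norm_le_of_radialProj_close`). Hence two such points of a small piece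
`φ(N)` of a patch have parameters `O(δ)` apart, the whole set of them is contained in the image of
a ball of radius `O(δ)` in `ℝᵐ`, and its `m`-dimensional measure is `O(δᵐ)`
(`exists_nhds_norm_sub_le_of_radialProj_close`, `hasTransversalityBound_image`).

The visibility bounds come from a second moment argument. A covering argument yields a finite
measure `ν ≠ 0`, a restriction of the Hausdorff measure on `E`, with `ν (B(x, δ)) ≤ C δˢ` for
`ν`-almost every `x` (`exists_measurableSet_hausdorffMeasure_ball_le`). For `t` comparable to `r`
put `f(a, θ) = ν {x : |P_a x - θ| ≤ t}`; if `f(a, θ) ≠ 0` then `θ` is a direction in which the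
`r`-neighbourhood of `E` is seen from `a`. By the Cauchy-Schwarz inequality on `A × Sᵐ`
(`sq_lintegral_measure_slice_le`) the measure of `{f ≠ 0}` is at least `(∫ f)² / ∫ f²`. Spherical
caps of radius `t` have measure comparable to `tᵐ`, so `∫ f` is at least a constant times `tᵐ`,
while `∫ f²` is at most a constant times `tᵐ` times the `ν × ν`-integral of the measure of
`{a : |P_a x - P_a y| ≤ 2t}`. Transversality bounds this last measure by a constant times
`min(1, (t / |x - y|)ᵐ)`, and summing over the dyadic balls `B(x, 2ᵏ t)` bounds the integral by
`tˢ ∑ₖ 2^((s - m) k)`, the sum running up to the diameter of `E`. This is `O(tˢ)` for `s < m` and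
`O(tˢ log (1 / t))` for `s = m`.
-/

/-! ### Upper density of Hausdorff measure -/

/-- A set `E` of positive finite `s`-dimensional measure has a part `G` of positive measure on which
the measure of balls decays like the `s`-th power of the radius. By a Vitali covering, the points
at which `ν (B(x, δ)) > 2 · 10ˢ δˢ` for arbitrarily small `δ` carry at most half of the measure.
The set `E` is not assumed to be measurable. -/
theorem exists_measurableSet_hausdorffMeasure_ball_le {X : Type*} [MetricSpace X]
    [SecondCountableTopology X] [MeasurableSpace X] [BorelSpace X] {s : ℝ} (hs : 0 ≤ s)
    {E : Set X} (hpos : 0 < μH[s] E) (hfin : μH[s] E < ⊤) :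
    ∃ C : ℝ, 0 < C ∧ ∃ G : Set X, MeasurableSet G ∧ 0 < (μH[s]).restrict E G ∧
      ∀ x ∈ G, ∀ δ : ℝ, 0 < δ →
        (μH[s]).restrict E (Metric.ball x δ) ≤ ENNReal.ofReal (C * δ ^ s) := by
  set ν : Measure X := (μH[s]).restrict E with hν
  set T : ENNReal := μH[s] E with hT
  have hTuniv : ν univ = T := by simp [hν, hT]
  have : IsFiniteMeasure ν := ⟨by rw [hTuniv]; exact hfin⟩
  set C₀ : ℝ := 2 * 10 ^ s with hC₀
  have hC₀pos : 0 < C₀ := by positivity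
  set B : ℕ → Set X := fun k => {x | ∃ δ : ℝ, 0 < δ ∧ δ < 1 / ((k : ℝ) + 1) ∧
    ENNReal.ofReal (C₀ * δ ^ s) < ν (Metric.ball x δ)} with hB
  have hBopen : ∀ k, IsOpen (B k) := by
    intro k
    rw [Metric.isOpen_iff]
    rintro x ⟨δ, hδ, hδk, hlt⟩
    -- continuity from below of `ν` along the balls of radius `δ - 1 / (j + 1)`
    have hU : Metric.ball x δ = ⋃ j : ℕ, Metric.ball x (δ - 1 / ((j : ℝ) + 1)) := by
      ext y
      simp only [Metric.mem_ball, mem_iUnion]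
      constructor
      · intro h
        obtain ⟨j, hj⟩ := exists_nat_one_div_lt (sub_pos.2 h)
        exact ⟨j, by linarith⟩
      · rintro ⟨j, hj⟩
        have : 0 < 1 / ((j : ℝ) + 1) := by positivity
        linarith
    have hmono : Monotone fun j : ℕ => Metric.ball x (δ - 1 / ((j : ℝ) + 1)) := by
      intro i j hij
      apply Metric.ball_subset_ball
      have : 1 / ((j : ℝ) + 1) ≤ 1 / ((i : ℝ) + 1) := by gcongr
      linarith
    have htend := tendsto_measure_iUnion_atTop (μ := ν) hmono
    rw [← hU] at htend
    obtain ⟨j, hj⟩ := (htend.eventually (lt_mem_nhds hlt)).exists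
    refine ⟨1 / ((j : ℝ) + 1), by positivity, fun y hy => ⟨δ, hδ, hδk, ?_⟩⟩
    refine hj.trans_le (measure_mono (Metric.ball_subset_ball' ?_))
    rw [Metric.mem_ball, dist_comm] at hy
    linarith
  have hhalf : μH[s] (⋂ k, B k) ≤ T / 2 := by
    have hch : ∀ k : ℕ, ∀ x : X, ∃ δ : ℝ, x ∈ B k → (0 < δ ∧ δ < 1 / ((k : ℝ) + 1) ∧
        ENNReal.ofReal (C₀ * δ ^ s) < ν (Metric.ball x δ)) := by
      intro k x
      by_cases h : x ∈ B k
      · obtain ⟨δ, h⟩ := h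
        exact ⟨δ, fun _ => h⟩
      · exact ⟨0, fun h' => absurd h' h⟩
    choose δ hδ using hch
    have hV : ∀ k : ℕ, ∃ u ⊆ (⋂ k, B k),
        (u.PairwiseDisjoint fun a => Metric.closedBall a (δ k a)) ∧
        ∀ a ∈ (⋂ k, B k), ∃ b ∈ u,
          Metric.closedBall a (δ k a) ⊆ Metric.closedBall b (5 * δ k b) := by
      intro k
      exact Vitali.exists_disjoint_subfamily_covering_enlargement_closedBall (⋂ k, B k) id
        (δ k) (1 / ((k : ℝ) + 1)) (fun a ha => (hδ k a (mem_iInter.1 ha k)).2.1.le) 5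
        (by norm_num)
    choose u hu hdisj hcov using hV
    have hprop : ∀ k, ∀ a ∈ u k, 0 < δ k a ∧ δ k a < 1 / ((k : ℝ) + 1) ∧
        ENNReal.ofReal (C₀ * δ k a ^ s) < ν (Metric.ball a (δ k a)) :=
      fun k a ha => hδ k a (mem_iInter.1 (hu k ha) k)
    have hcount : ∀ k, (u k).Countable := fun k =>
      (hdisj k).countable_of_nonempty_interior fun a ha =>
        ⟨a, mem_interior.2 ⟨_, Metric.ball_subset_closedBall, Metric.isOpen_ball,
          Metric.mem_ball_self (hprop k a ha).1⟩⟩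
    have : ∀ k, Countable (u k) := fun k => (hcount k).to_subtype
    have hdiam : ∀ k, ∀ a ∈ u k, Metric.ediam (Metric.closedBall a (5 * δ k a)) ≤
        ENNReal.ofReal (10 * δ k a) := by
      intro k a ha
      have h0 := (hprop k a ha).1
      refine Metric.ediam_le_of_forall_dist_le fun x hx y hy => ?_
      have := dist_triangle_right x y a
      rw [Metric.mem_closedBall] at hx hy
      linarith
    have hlim := MeasureTheory.Measure.hausdorffMeasure_le_liminf_tsum s (⋂ k, B k)
      (l := Filter.atTop) (fun k : ℕ => ENNReal.ofReal (10 * (1 / ((k : ℝ) + 1)))) ?_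
      (fun k (a : u k) => Metric.closedBall (a : X) (5 * δ k a)) ?_ ?_
    · refine hlim.trans ?_
      refine Filter.liminf_le_of_le (by isBoundedDefault) fun b hb => ?_
      obtain ⟨k, hk⟩ := hb.exists
      refine hk.trans ?_
      have hterm : ∀ a : u k, Metric.ediam (Metric.closedBall (a : X) (5 * δ k a)) ^ s ≤
          ν (Metric.closedBall (a : X) (δ k a)) / 2 := by
        intro a
        obtain ⟨h0, -, h2⟩ := hprop k a a.2
        calc Metric.ediam (Metric.closedBall (a : X) (5 * δ k a)) ^ s
            ≤ ENNReal.ofReal (10 * δ k a) ^ s := by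
              gcongr
              exact hdiam k a a.2
          _ = ENNReal.ofReal (C₀ * δ k a ^ s) / 2 := by
              rw [ENNReal.ofReal_rpow_of_nonneg (by positivity) hs,
                Real.mul_rpow (by norm_num) h0.le, hC₀, mul_assoc,
                ENNReal.ofReal_mul (p := 2) (by norm_num), ENNReal.ofReal_ofNat,
                mul_comm (2 : ENNReal), ENNReal.mul_div_cancel_right (by simp) (by simp)]
          _ ≤ ν (Metric.closedBall (a : X) (δ k a)) / 2 := by
              gcongr
              exact h2.le.trans (measure_mono Metric.ball_subset_closedBall)
      calc ∑' a : u k, Metric.ediam (Metric.closedBall (a : X) (5 * δ k a)) ^ s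
          ≤ ∑' a : u k, ν (Metric.closedBall (a : X) (δ k a)) / 2 := ENNReal.tsum_le_tsum hterm
        _ = (∑' a : u k, ν (Metric.closedBall (a : X) (δ k a))) / 2 := by
            simp_rw [div_eq_mul_inv]
            rw [ENNReal.tsum_mul_right]
        _ = ν (⋃ a ∈ u k, Metric.closedBall (a : X) (δ k a)) / 2 := by
            rw [measure_biUnion (hcount k) (hdisj k)
              (fun a _ => Metric.isClosed_closedBall.measurableSet)]
        _ ≤ T / 2 := by
            gcongr
            rw [← hTuniv]
            exact measure_mono (subset_univ _)
    · have h1 : Filter.Tendsto (fun k : ℕ => 10 * (1 / ((k : ℝ) + 1))) Filter.atTop (nhds 0) := by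
        simpa using tendsto_one_div_add_atTop_nhds_zero_nat.const_mul (10 : ℝ)
      simpa using ENNReal.tendsto_ofReal h1
    · refine Filter.Eventually.of_forall fun k a => (hdiam k a a.2).trans ?_
      have := (hprop k a a.2).2.1
      gcongr
    · refine Filter.Eventually.of_forall fun k x hx => ?_
      obtain ⟨b, hb, hsub⟩ := hcov k x hx
      refine mem_iUnion.2 ⟨⟨b, hb⟩, hsub ?_⟩
      exact Metric.mem_closedBall_self (hδ k x (mem_iInter.1 hx k)).1.le
  have hanti : Antitone B := by
    rintro i j hij x ⟨δ, h0, h1, h2⟩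
    refine ⟨δ, h0, h1.trans_le ?_, h2⟩
    gcongr
  have htend := tendsto_measure_iInter_atTop (μ := ν)
    (fun k => (hBopen k).measurableSet.nullMeasurableSet) hanti ⟨0, measure_ne_top ν _⟩
  have hlt : ν (⋂ k, B k) < T :=
    ((Measure.restrict_apply_le _ _).trans hhalf).trans_lt
      (ENNReal.half_lt_self hpos.ne' hfin.ne)
  obtain ⟨k, hk⟩ := (htend.eventually (gt_mem_nhds hlt)).exists
  have hT0 : 0 ≤ T.toReal := ENNReal.toReal_nonneg
  refine ⟨C₀ + T.toReal * ((k : ℝ) + 1) ^ s, by positivity, (B k)ᶜ,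
    (hBopen k).measurableSet.compl, ?_, ?_⟩
  · rw [measure_compl (hBopen k).measurableSet (measure_ne_top ν _), hTuniv]
    exact tsub_pos_of_lt hk
  · intro x hx δ hδ
    have hδs : 0 ≤ δ ^ s := by positivity
    by_cases h : δ < 1 / ((k : ℝ) + 1)
    · have h2 : ν (Metric.ball x δ) ≤ ENNReal.ofReal (C₀ * δ ^ s) := by
        by_contra hcon
        exact hx ⟨δ, hδ, h, not_le.1 hcon⟩
      refine h2.trans (ENNReal.ofReal_le_ofReal ?_)
      have : 0 ≤ T.toReal * ((k : ℝ) + 1) ^ s := by positivity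
      nlinarith
    · have h1 : 1 ≤ ((k : ℝ) + 1) ^ s * δ ^ s := by
        rw [← Real.mul_rpow (by positivity) hδ.le]
        refine Real.one_le_rpow ?_ hs
        rw [not_lt, div_le_iff₀ (by positivity)] at h
        linarith
      calc ν (Metric.ball x δ) ≤ T := by
            rw [← hTuniv]; exact measure_mono (subset_univ _)
        _ = ENNReal.ofReal T.toReal := (ENNReal.ofReal_toReal hfin.ne).symm
        _ ≤ _ := by
            apply ENNReal.ofReal_le_ofReal
            have h3 : 0 ≤ C₀ * δ ^ s := by positivity
            have h4 := mul_le_mul_of_nonneg_left h1 hT0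
            nlinarith

/-! ### Hausdorff measure of balls and spherical caps -/

/-- A map that is antilipschitz on a set shrinks its Hausdorff measure by a bounded factor. -/
theorem hausdorffMeasure_le_mul_image_of_edist_le {X Y : Type*} [MetricSpace X] [MeasurableSpace X]
    [BorelSpace X] [MetricSpace Y] [MeasurableSpace Y] [BorelSpace Y] {f : X → Y} {S : Set X}
    {K : NNReal} {d : ℝ} (hd : 0 ≤ d)
    (h : ∀ x ∈ S, ∀ y ∈ S, edist x y ≤ K * edist (f x) (f y)) :
    μH[d] S ≤ (K : ENNReal) ^ d * μH[d] (f '' S) := by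
  have hanti : AntilipschitzWith K (fun x : S => f x) := fun x y => h x x.2 y y.2
  have h1 := hanti.le_hausdorffMeasure_image hd univ
  have h2 := (isometry_subtype_coe (s := S)).hausdorffMeasure_image (Or.inl hd) univ
  rw [← h2, image_univ, Subtype.range_coe] at h1
  rwa [image_univ, show range (fun x : S => f x) = f '' S from (image_eq_range f S).symm] at h1

theorem hausdorffMeasure_euclideanBall {m : ℕ} (hm : 1 ≤ m) :
    ∃ b : ℝ, 0 < b ∧ ∀ (x : EuclideanSpace ℝ (Fin m)) (r : ℝ), 0 ≤ r →
      μH[m] (Metric.ball x r) = ENNReal.ofReal (b * r ^ m) := by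
  have : NeZero m := ⟨by omega⟩
  have hH : (μH[(Module.finrank ℝ (EuclideanSpace ℝ (Fin m)) : ℝ)] :
      Measure (EuclideanSpace ℝ (Fin m))).IsAddHaarMeasure := inferInstance
  rw [finrank_euclideanSpace_fin] at hH
  have hne : μH[m] (Metric.ball (0 : EuclideanSpace ℝ (Fin m)) 1) ≠ ⊤ := measure_ball_lt_top.ne
  refine ⟨(μH[m] (Metric.ball (0 : EuclideanSpace ℝ (Fin m)) 1)).toReal,
    ENNReal.toReal_pos (Metric.measure_ball_pos _ _ one_pos).ne' hne, fun x r hr => ?_⟩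
  rw [Measure.addHaar_ball _ x hr, finrank_euclideanSpace_fin, mul_comm,
    ENNReal.ofReal_mul ENNReal.toReal_nonneg, ENNReal.ofReal_toReal hne]

theorem norm_normalize_sub_normalize_le {V : Type*} [NormedAddCommGroup V] [NormedSpace ℝ V]
    {x y : V} (hx : 1 ≤ ‖x‖) (hy : 1 ≤ ‖y‖) :
    ‖‖x‖⁻¹ • x - ‖y‖⁻¹ • y‖ ≤ 2 * ‖x - y‖ := by
  have hx0 : 0 < ‖x‖ := by linarith
  have hy0 : 0 < ‖y‖ := by linarith
  have h1 : ‖x‖⁻¹ • x - ‖y‖⁻¹ • y = ‖x‖⁻¹ • ((x - y) + ((‖y‖ - ‖x‖) * ‖y‖⁻¹) • y) := by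
    have : (‖y‖ - ‖x‖) * ‖y‖⁻¹ = 1 - ‖x‖ * ‖y‖⁻¹ := by field_simp
    rw [this, sub_smul, one_smul, smul_add, smul_sub, smul_sub, smul_smul, ← mul_assoc,
      inv_mul_cancel₀ hx0.ne', one_mul]
    abel
  have h2 : |‖y‖ - ‖x‖| ≤ ‖x - y‖ := by rw [norm_sub_rev]; exact abs_norm_sub_norm_le y x
  have h3 : ‖((‖y‖ - ‖x‖) * ‖y‖⁻¹) • y‖ = |‖y‖ - ‖x‖| := by
    rw [norm_smul, norm_mul, norm_inv, norm_norm, mul_assoc, inv_mul_cancel₀ hy0.ne', mul_one,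
      Real.norm_eq_abs]
  rw [h1, norm_smul, norm_inv, norm_norm]
  calc ‖x‖⁻¹ * ‖(x - y) + ((‖y‖ - ‖x‖) * ‖y‖⁻¹) • y‖
      ≤ 1 * (‖x - y‖ + ‖x - y‖) := by
        gcongr
        · exact inv_le_one_of_one_le₀ hx
        · exact (norm_add_le _ _).trans (by rw [h3]; gcongr)
    _ = 2 * ‖x - y‖ := by ring

section Sphere

variable {m : ℕ}

local notation "𝕍" => EuclideanSpace ℝ (Fin (m + 1))
local notation "𝕎" => EuclideanSpace ℝ (Fin m)

/-- The hyperplane orthogonal to a unit vector `θ`, parametrised by an isometry `j`, with `p` the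
orthogonal projection onto it read in this parametrisation. -/
theorem exists_linearIsometry_orthogonal {θ : 𝕍} (hθ : ‖θ‖ = 1) :
    ∃ (j : 𝕎 →ₗᵢ[ℝ] 𝕍) (p : 𝕍 →L[ℝ] 𝕎), (∀ w, inner ℝ θ (j w) = 0) ∧
      (∀ x, inner ℝ θ x = 0 → j (p x) = x) ∧ (∀ w, p (j w) = w) ∧ p θ = 0 ∧
      LipschitzWith 1 p := by
  have hθ0 : θ ≠ 0 := by rintro rfl; simp at hθ
  have : Fact (Module.finrank ℝ 𝕍 = m + 1) := ⟨finrank_euclideanSpace_fin⟩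
  let B := OrthonormalBasis.fromOrthogonalSpanSingleton (𝕜 := ℝ) m hθ0
  let K := (Submodule.span ℝ {θ})ᗮ
  let j : 𝕎 →ₗᵢ[ℝ] 𝕍 := K.subtypeₗᵢ.comp B.repr.symm.toLinearIsometry
  let p : 𝕍 →L[ℝ] 𝕎 := (B.repr.toContinuousLinearEquiv : K →L[ℝ] 𝕎).comp K.orthogonalProjectionOnto
  refine ⟨j, p, fun w => ?_, fun x hx => ?_, fun w => ?_, ?_, ?_⟩
  · exact (Submodule.mem_orthogonal_singleton_iff_inner_right.1 (B.repr.symm w).2)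
  · have hxK : x ∈ K := Submodule.mem_orthogonal_singleton_iff_inner_right.2 hx
    have : K.orthogonalProjectionOnto x = ⟨x, hxK⟩ :=
      Submodule.orthogonalProjectionOnto_mem_subspace_eq_self ⟨x, hxK⟩
    simp [j, p, this]
  · simp [j, p]
  · have : K.orthogonalProjectionOnto θ = 0 :=
      Submodule.orthogonalProjectionOnto_orthogonal_apply_eq_zero
        (Submodule.mem_span_singleton_self θ)
    simp [p, this]
  · have h1 : LipschitzWith 1 K.orthogonalProjectionOnto := K.lipschitzWith_orthogonalProjectionOnto
    have h2 := B.repr.isometry.lipschitz.comp h1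
    rwa [one_mul] at h2

/-- Spherical caps are at least as large as their orthogonal projections to the tangent hyperplane,
and the projection of the cap of radius `δ` contains the ball of radius `δ / 2`. -/
theorem exists_le_hausdorffMeasure_cap (hm : 1 ≤ m) :
    ∃ c : ℝ, 0 < c ∧ ∀ θ : 𝕍, ‖θ‖ = 1 → ∀ δ : ℝ, 0 < δ → δ < 1 →
      ENNReal.ofReal (c * δ ^ m) ≤ μH[m] (Metric.ball θ δ ∩ Metric.sphere 0 1) := by
  obtain ⟨b, hb, hball⟩ := hausdorffMeasure_euclideanBall hm
  refine ⟨b * (1 / 2) ^ m, by positivity, fun θ hθ δ hδ hδ1 => ?_⟩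
  obtain ⟨j, p, hj, -, hpj, hpθ, hp⟩ := exists_linearIsometry_orthogonal hθ
  have hsub : Metric.ball (0 : 𝕎) (δ / 2) ⊆ p '' (Metric.ball θ δ ∩ Metric.sphere 0 1) := by
    intro w hw
    rw [mem_ball_zero_iff] at hw
    have hw0 := norm_nonneg w
    have hw2 : ‖w‖ ^ 2 ≤ 1 / 4 := by nlinarith
    have hs2 : Real.sqrt (1 - ‖w‖ ^ 2) ^ 2 = 1 - ‖w‖ ^ 2 := Real.sq_sqrt (by linarith)
    set q := Real.sqrt (1 - ‖w‖ ^ 2) with hq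
    have hq0 : 0 ≤ q := Real.sqrt_nonneg _
    have hnorm : ∀ c : ℝ, ‖j w + c • θ‖ ^ 2 = ‖w‖ ^ 2 + c ^ 2 := by
      intro c
      rw [norm_add_sq_real, inner_smul_right, real_inner_comm, hj, norm_smul, hθ, j.norm_map]
      simp
    refine ⟨j w + q • θ, ⟨?_, ?_⟩, by simp [hpj, hpθ]⟩
    · rw [Metric.mem_ball, dist_eq_norm,
        show j w + q • θ - θ = j w + (q - 1) • θ by rw [sub_smul, one_smul]; abel]
      have h1 := hnorm (q - 1)
      have h2 : (1 - q) ≤ ‖w‖ ^ 2 := by nlinarith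
      have h3 : q ≤ 1 := by nlinarith
      apply lt_of_pow_lt_pow_left₀ 2 hδ.le
      rw [h1]
      nlinarith
    · rw [mem_sphere_zero_iff_norm]
      have h1 := hnorm q
      rw [hs2] at h1
      have h2 := norm_nonneg (j w + q • θ)
      nlinarith
  calc ENNReal.ofReal (b * (1 / 2) ^ m * δ ^ m) = μH[m] (Metric.ball (0 : 𝕎) (δ / 2)) := by
        rw [hball _ _ (by positivity)]
        congr 1
        rw [mul_assoc, ← mul_pow]
        congr 2
        ring
    _ ≤ μH[m] (p '' (Metric.ball θ δ ∩ Metric.sphere 0 1)) := measure_mono hsub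
    _ ≤ μH[m] (Metric.ball θ δ ∩ Metric.sphere 0 1) := by
        simpa using hp.hausdorffMeasure_image_le (d := m) (by positivity) _

/-- The spherical cap of radius `δ` is contained in the central projection of the ball of radius
`2 δ` in the tangent hyperplane, and the central projection is Lipschitz there. -/
theorem exists_hausdorffMeasure_cap_le (hm : 1 ≤ m) :
    ∃ C : ℝ, 0 < C ∧ ∀ θ : 𝕍, ‖θ‖ = 1 → ∀ δ : ℝ, 0 < δ → δ ≤ 1 / 2 →
      μH[m] (Metric.closedBall θ δ ∩ Metric.sphere 0 1) ≤ ENNReal.ofReal (C * δ ^ m) := by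
  obtain ⟨b, hb, hball⟩ := hausdorffMeasure_euclideanBall hm
  refine ⟨2 ^ m * (b * 2 ^ m), by positivity, fun θ hθ δ hδ hδ1 => ?_⟩
  obtain ⟨j, p, hj, hjp, -⟩ := exists_linearIsometry_orthogonal hθ
  set g : 𝕎 → 𝕍 := fun w => ‖θ + j w‖⁻¹ • (θ + j w) with hg
  have hnorm : ∀ w, 1 ≤ ‖θ + j w‖ := by
    intro w
    have h1 : ‖θ + j w‖ ^ 2 = 1 + ‖w‖ ^ 2 := by
      rw [norm_add_sq_real, hj, hθ, j.norm_map]; simp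
    have h2 := norm_nonneg (θ + j w)
    nlinarith [sq_nonneg ‖w‖]
  have hgl : LipschitzWith 2 g := by
    refine LipschitzWith.of_dist_le_mul fun x y => ?_
    rw [dist_eq_norm, dist_eq_norm]
    refine (norm_normalize_sub_normalize_le (hnorm x) (hnorm y)).trans_eq ?_
    rw [add_sub_add_left_eq_sub, ← map_sub, j.norm_map]
    rfl
  have hsub : Metric.closedBall θ δ ∩ Metric.sphere 0 1 ⊆ g '' Metric.ball 0 (2 * δ) := by
    rintro u ⟨hu, hu1⟩
    rw [mem_sphere_zero_iff_norm] at hu1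
    rw [Metric.mem_closedBall, dist_eq_norm] at hu
    set c : ℝ := inner ℝ θ u with hc
    have h1 : ‖u - θ‖ ^ 2 = 2 - 2 * c := by
      rw [norm_sub_sq_real, real_inner_comm, hu1, hθ]; ring
    have h0 := norm_nonneg (u - θ)
    have hc1 : 7 / 8 ≤ c := by nlinarith
    have hc2 : c ≤ 1 := by nlinarith
    have hx : inner ℝ θ (u - c • θ) = 0 := by
      rw [inner_sub_right, inner_smul_right, real_inner_self_eq_norm_sq, hθ, ← hc]; ring
    have hxn : ‖u - c • θ‖ ^ 2 = 1 - c ^ 2 := by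
      rw [norm_sub_sq_real, inner_smul_right, real_inner_comm, norm_smul, hu1, hθ, ← hc]
      simp only [Real.norm_eq_abs, mul_one, sq_abs]; ring
    have hc0 : 0 < c := by linarith
    have hjw := hjp _ hx
    have hadd : θ + j (c⁻¹ • p (u - c • θ)) = c⁻¹ • u := by
      rw [map_smul, hjw, smul_sub, smul_smul, inv_mul_cancel₀ hc0.ne', one_smul]
      abel
    refine ⟨c⁻¹ • p (u - c • θ), ?_, ?_⟩
    · rw [mem_ball_zero_iff, norm_smul, ← j.norm_map, hjw, norm_inv, Real.norm_of_nonneg hc0.le,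
        inv_mul_lt_iff₀ hc0]
      apply lt_of_pow_lt_pow_left₀ 2 (by positivity)
      rw [hxn]
      have h5 : 1 - c ^ 2 ≤ δ ^ 2 := by nlinarith
      have h6 : (7 / 8) ^ 2 ≤ c ^ 2 := by gcongr
      nlinarith [sq_nonneg δ, mul_pos hδ hδ]
    · simp only [hg]
      rw [hadd, norm_smul, hu1, mul_one, norm_inv, inv_inv, Real.norm_of_nonneg hc0.le, smul_smul,
        mul_inv_cancel₀ hc0.ne', one_smul]
  calc μH[m] (Metric.closedBall θ δ ∩ Metric.sphere 0 1)
      ≤ μH[m] (g '' Metric.ball 0 (2 * δ)) := measure_mono hsub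
    _ ≤ ((2 : NNReal) : ENNReal) ^ (m : ℝ) * μH[m] (Metric.ball (0 : 𝕎) (2 * δ)) :=
        hgl.hausdorffMeasure_image_le (by positivity) _
    _ = ENNReal.ofReal (2 ^ m * (b * 2 ^ m) * δ ^ m) := by
        rw [hball _ _ (by positivity), ENNReal.rpow_natCast,
          show ((2 : NNReal) : ENNReal) ^ m = ENNReal.ofReal (2 ^ m) by
            rw [ENNReal.ofReal_pow (by norm_num)]; simp,
          ← ENNReal.ofReal_mul (by positivity)]
        congr 1
        ring

theorem hausdorffMeasure_sphere_lt_top (hm : 1 ≤ m) :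
    μH[m] (Metric.sphere (0 : 𝕍) 1) < ⊤ := by
  obtain ⟨C, -, hC⟩ := exists_hausdorffMeasure_cap_le hm
  obtain ⟨t, hts, htf, hcov⟩ := (isCompact_sphere (0 : 𝕍) 1).finite_cover_balls
    (show (0 : ℝ) < 1 / 2 by norm_num)
  have hsub : Metric.sphere (0 : 𝕍) 1 ⊆
      ⋃ x ∈ t, (Metric.closedBall x (1 / 2) ∩ Metric.sphere 0 1) := by
    intro y hy
    obtain ⟨x, hx, hyx⟩ := mem_iUnion₂.1 (hcov hy)
    exact mem_iUnion₂.2 ⟨x, hx, Metric.ball_subset_closedBall hyx, hy⟩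
  refine (measure_mono hsub).trans_lt (measure_biUnion_lt_top htf fun x hx => ?_)
  exact (hC x (mem_sphere_zero_iff_norm.1 (hts hx)) (1 / 2) (by norm_num) le_rfl).trans_lt
    ENNReal.ofReal_lt_top

end Sphere

/-! ### Transversality of radial projections along a patch -/

/-- The geometry behind transversality. If `x` and `y` are seen from `a` in directions that differ by
at most `δ |x - y|`, then `a` is `O(δ)`-close to the line through `x` and `y`; and if moreover `y`
stays at distance `ρ` from the plane `a + L`, then the direction of this line makes an angle with
`L` that is bounded below. -/
theorem norm_le_of_radialProj_close {n : ℕ} {a x y : EuclideanSpace ℝ (Fin n)}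
    {L : Submodule ℝ (EuclideanSpace ℝ (Fin n))} {R ρ δ : ℝ} (hR : 0 < R) (hρ : 0 < ρ)
    (hxR : ‖x - a‖ ≤ R) (hyR : ‖y - a‖ ≤ R) (hxa : x ≠ a)
    (hL : ∀ w ∈ L, ρ ≤ ‖y - a - w‖) (hxy : x ≠ y) (hδR : δ * (2 * R) ≤ 1)
    (hδρ : δ * (4 * R ^ 2) ≤ ρ) (hδ : 0 < δ)
    (hclose : ‖radialProj a x - radialProj a y‖ ≤ δ * ‖x - y‖) :
    (∃ t : ℝ, ‖(y - a) - t • (x - y)‖ ≤ 2 * R ^ 2 * δ) ∧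
      ∀ w ∈ L, ∀ t : ℝ, ‖w‖ ≤ (1 + 4 * R / ρ) * ‖w - t • (x - y)‖ := by
  have hd : 0 < ‖x - y‖ := norm_pos_iff.2 (sub_ne_zero.2 hxy)
  have hp : 0 < ‖x - a‖ := norm_pos_iff.2 (sub_ne_zero.2 hxa)
  have hq : 0 < ‖y - a‖ := by
    have := hL 0 L.zero_mem
    rw [sub_zero] at this
    linarith
  set w₀ := radialProj a x - radialProj a y with hw₀
  -- `x - y = l • (y - a) + z` with `‖z‖ ≤ R δ ‖x - y‖`
  set l : ℝ := ‖x - a‖ * ‖y - a‖⁻¹ - 1 with hl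
  set z := ‖x - a‖ • w₀ with hz
  have hdec : x - y = l • (y - a) + z := by
    simp only [hz, hw₀, hl, radialProj, smul_sub, sub_smul, one_smul, smul_smul]
    rw [mul_inv_cancel₀ hp.ne']
    module
  have hzn : ‖z‖ ≤ R * δ * ‖x - y‖ := by
    rw [hz, norm_smul, norm_norm, mul_assoc]
    gcongr
  have hRδ : R * δ ≤ 1 / 2 := by linarith
  have hlq : ‖x - y‖ / 2 ≤ |l| * ‖y - a‖ := by
    have h1 : ‖x - y‖ ≤ |l| * ‖y - a‖ + ‖z‖ := by
      rw [← Real.norm_eq_abs, ← norm_smul]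
      nth_rewrite 1 [hdec]
      exact norm_add_le _ _
    have h2 := mul_le_mul_of_nonneg_right hRδ hd.le
    linarith
  have hlR : ‖x - y‖ ≤ 2 * R * |l| := by
    have := mul_le_mul_of_nonneg_left hyR (abs_nonneg l)
    linarith
  have hl0 : 0 < |l| := by
    by_contra h
    have : |l| = 0 := le_antisymm (not_lt.1 h) (abs_nonneg l)
    rw [this] at hlR
    linarith
  have hl0' : l ≠ 0 := abs_pos.1 hl0
  refine ⟨⟨l⁻¹, ?_⟩, fun w hw t => ?_⟩
  · have h1 : (y - a) - l⁻¹ • (x - y) = -(l⁻¹ • z) := by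
      rw [hdec, smul_add, smul_smul, inv_mul_cancel₀ hl0', one_smul]
      abel
    rw [h1, norm_neg, norm_smul, norm_inv, Real.norm_eq_abs, inv_mul_le_iff₀ hl0]
    have h2 := mul_le_mul_of_nonneg_left hlR (mul_nonneg hR.le hδ.le)
    linarith
  · have h1 : |t * l| * ρ ≤ ‖w - (t * l) • (y - a)‖ := by
      rcases eq_or_ne (t * l) 0 with h | h
      · rw [h]; simp
      · have h2 := hL ((t * l)⁻¹ • w) (L.smul_mem _ hw)
        have h3 : w - (t * l) • (y - a) = -((t * l) • (y - a - (t * l)⁻¹ • w)) := by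
          rw [smul_sub _ (y - a), smul_smul, mul_inv_cancel₀ h, one_smul]
          abel
        rw [h3, norm_neg, norm_smul, Real.norm_eq_abs]
        gcongr
    have h4 : w - (t * l) • (y - a) = (w - t • (x - y)) + t • z := by
      rw [hdec, smul_add, smul_smul]
      abel
    have h5 : ‖w - (t * l) • (y - a)‖ ≤ ‖w - t • (x - y)‖ + |t| * ‖z‖ := by
      rw [h4]
      refine (norm_add_le _ _).trans_eq ?_
      rw [norm_smul, Real.norm_eq_abs]
    have h6 : ‖w‖ ≤ ‖w - t • (x - y)‖ + |t| * ‖x - y‖ := by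
      have : w = (w - t • (x - y)) + t • (x - y) := by abel
      nth_rewrite 1 [this]
      refine (norm_add_le _ _).trans_eq ?_
      rw [norm_smul, Real.norm_eq_abs]
    have ht := abs_nonneg t
    set N := ‖w - t • (x - y)‖ with hN
    have htd : 0 ≤ |t| * ‖x - y‖ := by positivity
    have h7 : |t| * ‖x - y‖ * ρ ≤ 4 * R * N := by
      rw [abs_mul] at h1
      have h8 : |t| * ‖z‖ ≤ R * δ * (|t| * ‖x - y‖) := by
        have := mul_le_mul_of_nonneg_left hzn ht
        linarith
      have h9 : |t| * ‖x - y‖ * ρ ≤ 2 * R * (|t| * |l| * ρ) := by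
        have := mul_le_mul_of_nonneg_left hlR (mul_nonneg ht hρ.le)
        linarith
      have h10 : 2 * R * (R * δ * (|t| * ‖x - y‖)) ≤ ρ / 2 * (|t| * ‖x - y‖) := by
        have : 2 * R * (R * δ) ≤ ρ / 2 := by linarith
        have := mul_le_mul_of_nonneg_right this htd
        linarith
      have h11 : 2 * R * (|t| * |l| * ρ) ≤ 2 * R * (N + R * δ * (|t| * ‖x - y‖)) := by
        gcongr
        linarith
      linarith
    have h12 : |t| * ‖x - y‖ ≤ 4 * R / ρ * N := by
      rw [div_mul_eq_mul_div, le_div_iff₀ hρ]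
      exact h7
    linarith

/-- Near a point of a patch whose tangent plane avoids `F`, any two parameters whose images see
`x, y ∈ F` in directions at most `δ |x - y|` apart are themselves `O(δ)` apart, uniformly in `x`
and `y`. -/
theorem exists_nhds_norm_sub_le_of_radialProj_close {n : ℕ} {W : Type*} [NormedAddCommGroup W]
    [NormedSpace ℝ W] [FiniteDimensional ℝ W] {φ : W → EuclideanSpace ℝ (Fin n)} {u₀ : W}
    {T : W →L[ℝ] EuclideanSpace ℝ (Fin n)} (hT : HasStrictFDerivAt φ T u₀)
    (hinj : Function.Injective T) {F : Set (EuclideanSpace ℝ (Fin n))} {R ρ : ℝ} (hR : 0 ≤ R)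
    (hρ : 0 < ρ) (hFR : ∀ e ∈ F, ‖e - φ u₀‖ ≤ R)
    (hFρ : ∀ e ∈ F, ∀ h : W, ρ ≤ ‖e - φ u₀ - T h‖) :
    ∃ N ∈ nhds u₀, ∃ C δ₁ : ℝ, 0 < C ∧ 0 < δ₁ ∧ ∀ x ∈ F, ∀ y ∈ F, x ≠ y →
      ∀ δ : ℝ, 0 < δ → δ ≤ δ₁ → ∀ u ∈ N, ∀ v ∈ N,
        ‖radialProj (φ u) x - radialProj (φ u) y‖ ≤ δ * ‖x - y‖ →
        ‖radialProj (φ v) x - radialProj (φ v) y‖ ≤ δ * ‖x - y‖ → ‖u - v‖ ≤ C * δ := by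
  obtain ⟨K, hK0, hK⟩ := (T : W →ₗ[ℝ] EuclideanSpace ℝ (Fin n)).exists_antilipschitzWith
    (LinearMap.ker_eq_bot.2 hinj)
  have hKn : ∀ h : W, ‖h‖ ≤ K * ‖T h‖ := fun h => by
    simpa using hK.le_mul_norm_sub h 0
  have hK0' : (0 : ℝ) < K := hK0
  set R' : ℝ := R + 1 with hR'
  set ρ' : ℝ := ρ / 2 with hρ'
  have hR'0 : 0 < R' := by positivity
  have hρ'0 : 0 < ρ' := by positivity
  set M : ℝ := 1 + 4 * R' / ρ' with hM
  have hM0 : 0 < M := by positivity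
  -- with this linearisation error the error term is absorbed by half of `‖u - v‖`
  have hε : 0 < 1 / (2 * (K * M)) := by positivity
  obtain ⟨N₁, hN₁, happ⟩ := hT.approximates_deriv_on_nhds (c := ⟨1 / (2 * (K * M)), hε.le⟩)
    (Or.inr hε)
  have hN₂ : φ ⁻¹' Metric.ball (φ u₀) (min 1 ρ') ∈ nhds u₀ :=
    hT.continuousAt (Metric.ball_mem_nhds _ (lt_min one_pos hρ'0))
  refine ⟨N₁ ∩ φ ⁻¹' Metric.ball (φ u₀) (min 1 ρ'), Filter.inter_mem hN₁ hN₂,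
    8 * K * M * R' ^ 2, min (1 / (2 * R')) (ρ' / (4 * R' ^ 2)), by positivity, by positivity, ?_⟩
  intro x hx y hy hxy δ hδ hδ₁ u hu v hv hbu hbv
  have hδR : δ * (2 * R') ≤ 1 := by
    have := hδ₁.trans (min_le_left _ _)
    rwa [le_div_iff₀ (by positivity)] at this
  have hδρ : δ * (4 * R' ^ 2) ≤ ρ' := by
    have := hδ₁.trans (min_le_right _ _)
    rwa [le_div_iff₀ (by positivity)] at this
  have hnear : ∀ w ∈ φ ⁻¹' Metric.ball (φ u₀) (min 1 ρ'), ∀ e ∈ F,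
      ‖e - φ w‖ ≤ R' ∧ ∀ h : W, ρ' ≤ ‖e - φ w - T h‖ := by
    intro w hw e he
    have h1 : ‖φ w - φ u₀‖ < min 1 ρ' := by rw [← dist_eq_norm]; exact hw
    have h2 := h1.trans_le (min_le_left _ _)
    have h3 := h1.trans_le (min_le_right _ _)
    constructor
    · have h4 := norm_sub_le (e - φ u₀) (φ w - φ u₀)
      rw [sub_sub_sub_cancel_right] at h4
      have := hFR e he
      linarith
    · intro h
      have h4 := norm_add_le (e - φ w - T h) (φ w - φ u₀)
      have h5 : (e - φ w - T h) + (φ w - φ u₀) = e - φ u₀ - T h := by abel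
      rw [h5] at h4
      have := hFρ e he h
      linarith
  have key : ∀ w ∈ φ ⁻¹' Metric.ball (φ u₀) (min 1 ρ'),
      ‖radialProj (φ w) x - radialProj (φ w) y‖ ≤ δ * ‖x - y‖ →
      (∃ t : ℝ, ‖(y - φ w) - t • (x - y)‖ ≤ 2 * R' ^ 2 * δ) ∧
      ∀ h : W, ∀ t : ℝ, ‖T h‖ ≤ M * ‖T h - t • (x - y)‖ := by
    intro w hw hb
    have hxw : x ≠ φ w := by
      rintro h
      have := (hnear w hw x hx).2 0
      rw [map_zero, sub_zero, h, sub_self, norm_zero] at this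
      linarith
    obtain ⟨h1, h2⟩ := norm_le_of_radialProj_close (L := LinearMap.range (T : W →ₗ[ℝ] _)) hR'0 hρ'0
      (hnear w hw x hx).1 (hnear w hw y hy).1 hxw
      (by rintro _ ⟨h, rfl⟩; exact (hnear w hw y hy).2 h) hxy hδR hδρ hδ hb
    exact ⟨h1, fun h t => h2 _ ⟨h, rfl⟩ t⟩
  obtain ⟨⟨t₁, ht₁⟩, hTM⟩ := key u hu.2 hbu
  obtain ⟨⟨t₂, ht₂⟩, -⟩ := key v hv.2 hbv
  have h1 : ‖φ u - φ v - (t₂ - t₁) • (x - y)‖ ≤ 4 * R' ^ 2 * δ := by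
    have h2 : φ u - φ v - (t₂ - t₁) • (x - y) =
        ((y - φ v) - t₂ • (x - y)) - ((y - φ u) - t₁ • (x - y)) := by
      rw [sub_smul]; abel
    rw [h2]
    refine (norm_sub_le _ _).trans ?_
    linarith
  have h3 : ‖φ u - φ v - T (u - v)‖ ≤ 1 / (2 * (K * M)) * ‖u - v‖ := happ u hu.1 v hv.1
  have h4 : ‖T (u - v) - (t₂ - t₁) • (x - y)‖ ≤
      1 / (2 * (K * M)) * ‖u - v‖ + 4 * R' ^ 2 * δ := by
    have h5 : T (u - v) - (t₂ - t₁) • (x - y) =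
        (φ u - φ v - (t₂ - t₁) • (x - y)) - (φ u - φ v - T (u - v)) := by abel
    rw [h5]
    refine (norm_sub_le _ _).trans ?_
    linarith
  have h6 : ‖u - v‖ ≤ K * (M * (1 / (2 * (K * M)) * ‖u - v‖ + 4 * R' ^ 2 * δ)) :=
    (hKn _).trans (by gcongr; exact (hTM _ (t₂ - t₁)).trans (by gcongr))
  have h7 : K * (M * (1 / (2 * (K * M)) * ‖u - v‖ + 4 * R' ^ 2 * δ)) =
      ‖u - v‖ / 2 + 4 * K * M * R' ^ 2 * δ := by
    field_simp
  rw [h7] at h6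
  linarith

section Patch

variable {m n : ℕ}

local notation "𝕍" => EuclideanSpace ℝ (Fin n)
local notation "𝕎" => EuclideanSpace ℝ (Fin m)

theorem exists_nhds_hausdorffMeasure_image_pos (hm : 1 ≤ m) {φ : 𝕎 → 𝕍} {u : 𝕎} {T : 𝕎 →L[ℝ] 𝕍}
    (hT : HasStrictFDerivAt φ T u) (hinj : Function.Injective T) {O : Set 𝕎} (hO : O ∈ nhds u) :
    ∃ B ⊆ O, IsCompact B ∧ 0 < μH[m] (φ '' B) := by
  obtain ⟨K, hK0, hK⟩ := (T : 𝕎 →ₗ[ℝ] 𝕍).exists_antilipschitzWith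
    (LinearMap.ker_eq_bot.2 hinj)
  have hKn : ∀ h : 𝕎, ‖h‖ ≤ K * ‖T h‖ := fun h => by
    simpa using hK.le_mul_norm_sub h 0
  have hK0' : (0 : ℝ) < K := hK0
  have hε : 0 < 1 / (2 * (K : ℝ)) := by positivity
  obtain ⟨N, hN, happ⟩ := hT.approximates_deriv_on_nhds (c := ⟨1 / (2 * (K : ℝ)), hε.le⟩)
    (Or.inr hε)
  obtain ⟨r, hr, hball⟩ := Metric.nhds_basis_closedBall.mem_iff.1 (Filter.inter_mem hN hO)
  refine ⟨Metric.closedBall u r, fun x hx => (hball hx).2,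
    isCompact_closedBall u r, ?_⟩
  obtain ⟨b, hb, hvol⟩ := hausdorffMeasure_euclideanBall hm
  have hpos : 0 < μH[m] (Metric.closedBall u r) := by
    refine lt_of_lt_of_le ?_ (measure_mono Metric.ball_subset_closedBall)
    rw [hvol u r hr.le, ENNReal.ofReal_pos]
    positivity
  have hle := hausdorffMeasure_le_mul_image_of_edist_le (f := φ) (S := Metric.closedBall u r)
    (K := 2 * K) (d := m) (by positivity) (fun x hx y hy => by
      rw [edist_dist, edist_dist, ← ENNReal.ofReal_coe_nnreal, ← ENNReal.ofReal_mul (by positivity)]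
      apply ENNReal.ofReal_le_ofReal
      rw [dist_eq_norm, dist_eq_norm]
      have h1 : ‖φ x - φ y - T (x - y)‖ ≤ 1 / (2 * K) * ‖x - y‖ :=
        happ x (hball hx).1 y (hball hy).1
      have h2 : ‖T (x - y)‖ ≤ ‖φ x - φ y‖ + 1 / (2 * K) * ‖x - y‖ := by
        have h3 := norm_sub_le (φ x - φ y) (φ x - φ y - T (x - y))
        rw [sub_sub_cancel] at h3
        linarith
      have h4 : ‖x - y‖ ≤ K * (‖φ x - φ y‖ + 1 / (2 * K) * ‖x - y‖) :=
        (hKn _).trans (by gcongr)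
      have h5 : K * (‖φ x - φ y‖ + 1 / (2 * K) * ‖x - y‖) =
        K * ‖φ x - φ y‖ + ‖x - y‖ / 2 := by field_simp
      rw [h5] at h4
      push_cast
      linarith)
  by_contra hcon
  rw [not_lt, nonpos_iff_eq_zero] at hcon
  rw [hcon, mul_zero] at hle
  exact absurd hpos (not_lt.2 hle)

theorem hausdorffMeasure_image_lt_top (hm : 1 ≤ m) {D U : Set 𝕎} {φ : 𝕎 → 𝕍} (hD : IsCompact D)
    (hU : IsOpen U) (hDU : D ⊆ U) (hφ : ContDiffOn ℝ 1 φ U) : μH[m] (φ '' D) < ⊤ := by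
  obtain ⟨b, hb, hvol⟩ := hausdorffMeasure_euclideanBall hm
  refine hD.induction_on (p := fun S => μH[m] (φ '' S) < ⊤) (by simp)
    (fun s t hst ht => (measure_mono (image_mono hst)).trans_lt ht) (fun s t hs ht => ?_) ?_
  · rw [image_union]
    exact (measure_union_le _ _).trans_lt (ENNReal.add_lt_top.2 ⟨hs, ht⟩)
  · intro u hu
    obtain ⟨K, N, hN, hlip⟩ := ((hφ.contDiffAt (hU.mem_nhds (hDU hu))).hasStrictFDerivAt
      one_ne_zero).exists_lipschitzOnWith
    refine ⟨N ∩ Metric.ball u 1, mem_nhdsWithin_of_mem_nhds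
      (Filter.inter_mem hN (Metric.ball_mem_nhds _ one_pos)), ?_⟩
    refine ((hlip.mono inter_subset_left).hausdorffMeasure_image_le
      (d := m) (by positivity)).trans_lt ?_
    refine ENNReal.mul_lt_top (ENNReal.rpow_lt_top_of_nonneg (by positivity) (by simp)) ?_
    refine (measure_mono inter_subset_right).trans_lt ?_
    rw [hvol u 1 zero_le_one]
    exact ENNReal.ofReal_lt_top

/-- The tangent plane hypothesis propagates from almost every point of the surface to all points of
a patch and to the closure of `E`: images of open sets of parameters are not null, so the good
parameters are dense, and the distance condition is closed because `φ` is of class `C¹`. -/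
theorem le_norm_sub_of_ae_tangentPlaneAt (hm : 1 ≤ m) {D U : Set 𝕎} {φ : 𝕎 → 𝕍}
    {A E : Set 𝕍} {ρ : ℝ} (hcl : closure (interior D) = D) (hU : IsOpen U) (hDU : D ⊆ U)
    (hφ : ContDiffOn ℝ 1 φ U) (hinj : ∀ u ∈ D, Function.Injective (fderiv ℝ φ u))
    (hDA : φ '' D ⊆ A)
    (htan : ∀ᵐ a ∂((μH[m]).restrict A), ∀ p ∈ tangentPlaneAt A a, ∀ e ∈ E, ρ ≤ dist p e) :
    ∀ u ∈ D, ∀ e ∈ closure E, ∀ h : 𝕎, ρ ≤ ‖e - φ u - fderiv ℝ φ u h‖ := by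
  set S : Set 𝕎 := {u | u ∈ interior D ∧
    ∀ p ∈ tangentPlaneAt A (φ u), ∀ e ∈ E, ρ ≤ dist p e} with hS
  have hstrict : ∀ u ∈ D, HasStrictFDerivAt φ (fderiv ℝ φ u) u := fun u hu =>
    (hφ.contDiffAt (hU.mem_nhds (hDU hu))).hasStrictFDerivAt one_ne_zero
  have hdense : interior D ⊆ closure S := by
    intro u hu
    rw [mem_closure_iff_nhds]
    intro O hO
    obtain ⟨B, hB, hBc, hpos⟩ := exists_nhds_hausdorffMeasure_image_pos hm
      (hstrict u (interior_subset hu)) (hinj u (interior_subset hu))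
      (Filter.inter_mem hO (isOpen_interior.mem_nhds hu))
    by_contra hemp
    have hBD : B ⊆ D := fun x hx => interior_subset (hB hx).2
    have hcont : ContinuousOn φ B := hφ.continuousOn.mono (hBD.trans hDU)
    have hsub : φ '' B ⊆ {a | ¬ ∀ p ∈ tangentPlaneAt A a, ∀ e ∈ E, ρ ≤ dist p e} := by
      rintro _ ⟨v, hv, rfl⟩ hgood
      exact hemp ⟨v, (hB hv).1, (hB hv).2, hgood⟩
    have h0 := measure_mono_null hsub (ae_iff.1 htan)
    rw [Measure.restrict_apply (hBc.image_of_continuousOn hcont).measurableSet,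
      inter_eq_self_of_subset_left ((image_mono hBD).trans hDA)] at h0
    exact hpos.ne' h0
  have hSgood : ∀ u ∈ S, ∀ e ∈ E, ∀ h : 𝕎, ρ ≤ ‖e - φ u - fderiv ℝ φ u h‖ := by
    rintro u ⟨huD, hu⟩ e he h
    have hcone : fderiv ℝ φ u h ∈ tangentConeAt ℝ A (φ u) := by
      refine tangentConeAt_mono hDA ?_
      refine ((hstrict u (interior_subset huD)).hasFDerivAt.hasFDerivWithinAt
        (s := D)).mapsTo_tangent_cone ?_
      rw [tangentConeAt_of_mem_nhds (mem_interior_iff_mem_nhds.1 huD)]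
      trivial
    have h1 := hu (fderiv ℝ φ u h +ᵥ φ u)
      (AffineSubspace.vadd_mem_mk' _ (Submodule.subset_span hcone)) e he
    rw [dist_comm, dist_eq_norm, vadd_eq_add] at h1
    rwa [sub_sub, add_comm]
  have hDS : D ⊆ closure S := by
    rw [← hcl]
    exact closure_minimal hdense isClosed_closure
  have hSD : S ⊆ D := fun u hu => interior_subset hu.1
  intro u hu e he h
  have hE : ∀ e ∈ E, ρ ≤ ‖e - φ u - fderiv ℝ φ u h‖ := by
    intro e he
    have hc : ContinuousWithinAt (fun v => ‖e - φ v - fderiv ℝ φ v h‖) S u := by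
      have h1 : ContinuousWithinAt φ S u :=
        (hφ.continuousOn u (hDU hu)).mono (hSD.trans hDU)
      have h2 : ContinuousWithinAt (fderiv ℝ φ) S u :=
        ((hφ.continuousOn_fderiv_of_isOpen hU le_rfl) u (hDU hu)).mono (hSD.trans hDU)
      exact ((continuousWithinAt_const.sub h1).sub
        (h2.clm_apply continuousWithinAt_const)).norm
    exact ContinuousWithinAt.closure_le (hDS hu) continuousWithinAt_const hc
      fun v hv => hSgood v hv e he h
  have hc : Continuous fun e : 𝕍 => ‖e - φ u - fderiv ℝ φ u h‖ := by fun_prop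
  exact closure_minimal (t := {e | ρ ≤ ‖e - φ u - fderiv ℝ φ u h‖}) hE
    (isClosed_le continuous_const hc) he

/-- The transversality estimate over the part `T` of the surface, for pairs of points of `F`: the
viewpoints in `T` from which `x` and `y` appear in directions at most `δ |x - y|` apart have
`m`-dimensional measure at most `C δᵐ`. The measure is not normalised, and `δ` is restricted to
`(0, δ₁]`, so that the property passes to finite unions. -/
def HasTransversalityBound (m : ℕ) (F T : Set 𝕍) : Prop :=
  ∃ C δ₁ : ℝ, 0 < C ∧ 0 < δ₁ ∧ ∀ x ∈ F, ∀ y ∈ F, x ≠ y → ∀ δ : ℝ, 0 < δ → δ ≤ δ₁ →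
    μH[m] {a | a ∈ T ∧ ‖radialProj a x - radialProj a y‖ ≤ δ * ‖x - y‖} ≤
      ENNReal.ofReal (C * δ ^ m)

theorem HasTransversalityBound.empty (F : Set 𝕍) : HasTransversalityBound m F ∅ :=
  ⟨1, 1, one_pos, one_pos, fun x _ y _ _ δ _ _ => by simp⟩

theorem HasTransversalityBound.mono {F T T' : Set 𝕍} (h : HasTransversalityBound m F T')
    (hT : T ⊆ T') : HasTransversalityBound m F T := by
  obtain ⟨C, δ₁, hC, hδ₁, h⟩ := h
  refine ⟨C, δ₁, hC, hδ₁, fun x hx y hy hxy δ hδ hδ' =>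
    (measure_mono ?_).trans (h x hx y hy hxy δ hδ hδ')⟩
  exact fun a ha => ⟨hT ha.1, ha.2⟩

theorem HasTransversalityBound.union {F T T' : Set 𝕍} (h : HasTransversalityBound m F T)
    (h' : HasTransversalityBound m F T') : HasTransversalityBound m F (T ∪ T') := by
  obtain ⟨C, δ₁, hC, hδ₁, h⟩ := h
  obtain ⟨C', δ₁', hC', hδ₁', h'⟩ := h'
  refine ⟨C + C', min δ₁ δ₁', by positivity, by positivity, fun x hx y hy hxy δ hδ hδm => ?_⟩
  rw [add_mul, ENNReal.ofReal_add (by positivity) (by positivity)]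
  refine (measure_mono ?_).trans ((measure_union_le _ _).trans (add_le_add
    (h x hx y hy hxy δ hδ (hδm.trans (min_le_left _ _)))
    (h' x hx y hy hxy δ hδ (hδm.trans (min_le_right _ _)))))
  rintro a ⟨ha | ha, hb⟩
  · exact Or.inl ⟨ha, hb⟩
  · exact Or.inr ⟨ha, hb⟩

theorem hasTransversalityBound_image (hm : 1 ≤ m) {D U : Set 𝕎} {φ : 𝕎 → 𝕍} (hD : IsCompact D)
    (hU : IsOpen U) (hDU : D ⊆ U) (hφ : ContDiffOn ℝ 1 φ U)
    (hinj : ∀ u ∈ D, Function.Injective (fderiv ℝ φ u)) {F : Set 𝕍} {R ρ : ℝ} (hR : 0 ≤ R)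
    (hρ : 0 < ρ) (hFR : ∀ u ∈ D, ∀ e ∈ F, ‖e - φ u‖ ≤ R)
    (hFρ : ∀ u ∈ D, ∀ e ∈ F, ∀ h : 𝕎, ρ ≤ ‖e - φ u - fderiv ℝ φ u h‖) :
    HasTransversalityBound m F (φ '' D) := by
  obtain ⟨b, hb, hvol⟩ := hausdorffMeasure_euclideanBall hm
  refine hD.induction_on (p := fun S => HasTransversalityBound m F (φ '' S))
    (by rw [image_empty]; exact .empty F) (fun s t hst ht => ht.mono (image_mono hst))
    (fun s t hs ht => by rw [image_union]; exact hs.union ht) fun u₀ hu₀ => ?_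
  have hstrict := (hφ.contDiffAt (hU.mem_nhds (hDU hu₀))).hasStrictFDerivAt one_ne_zero
  obtain ⟨K, N, hN, hlip⟩ := hstrict.exists_lipschitzOnWith
  obtain ⟨N', hN', C, δ₁, hC, hδ₁, hloc⟩ := exists_nhds_norm_sub_le_of_radialProj_close hstrict
    (hinj u₀ hu₀) hR hρ (hFR u₀ hu₀) (hFρ u₀ hu₀)
  refine ⟨N ∩ N', mem_nhdsWithin_of_mem_nhds (Filter.inter_mem hN hN'),
    (K : ℝ) ^ m * (b * (2 * C) ^ m) + 1, δ₁, by positivity, hδ₁, ?_⟩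
  intro x hx y hy hxy δ hδ hδδ₁
  set Q : Set 𝕎 := {u | u ∈ N ∩ N' ∧
    ‖radialProj (φ u) x - radialProj (φ u) y‖ ≤ δ * ‖x - y‖} with hQ
  have hsub : {a | a ∈ φ '' (N ∩ N') ∧ ‖radialProj a x - radialProj a y‖ ≤ δ * ‖x - y‖} ⊆
      φ '' Q := by
    rintro _ ⟨⟨u, hu, rfl⟩, hbad⟩
    exact ⟨u, ⟨hu, hbad⟩, rfl⟩
  refine (measure_mono hsub).trans ?_
  rcases Q.eq_empty_or_nonempty with hemp | ⟨v, hv⟩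
  · simp [hemp]
  have hQball : Q ⊆ Metric.ball v (2 * C * δ) := by
    intro u hu
    rw [Metric.mem_ball, dist_eq_norm]
    have h1 := hloc x hx y hy hxy δ hδ hδδ₁ u hu.1.2 v hv.1.2 hu.2 hv.2
    have : 0 < C * δ := by positivity
    linarith
  calc μH[m] (φ '' Q) ≤ (K : ENNReal) ^ (m : ℝ) * μH[m] Q :=
        (hlip.mono fun u hu => hu.1.1).hausdorffMeasure_image_le (by positivity)
    _ ≤ (K : ENNReal) ^ (m : ℝ) * ENNReal.ofReal (b * (2 * C * δ) ^ m) := by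
        gcongr
        exact (measure_mono hQball).trans_eq (hvol v _ (by positivity))
    _ = ENNReal.ofReal ((K : ℝ) ^ m * (b * (2 * C) ^ m) * δ ^ m) := by
        rw [ENNReal.rpow_natCast, ← ENNReal.ofReal_coe_nnreal, ← ENNReal.ofReal_pow (by positivity),
          ← ENNReal.ofReal_mul (by positivity), mul_pow]
        congr 1
        ring
    _ ≤ _ := by
        apply ENNReal.ofReal_le_ofReal
        gcongr
        linarith

end Patch

/-! ### Second moment and energy estimates -/

/-- Second moment inequality: Cauchy-Schwarz for `f(p) = ν(W_p)` against the indicator of `f ≠ 0`,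
with `∫ f²` rewritten as a double integral over pairs of points. -/
theorem sq_lintegral_measure_slice_le {P X : Type*} [MeasurableSpace P] [MeasurableSpace X]
    {μ : Measure P} {ν : Measure X} [SFinite μ] [IsFiniteMeasure ν] {W : Set (P × X)}
    (hW : MeasurableSet W) :
    (∫⁻ p, ν {x | (p, x) ∈ W} ∂μ) ^ 2 ≤ μ {p | ν {x | (p, x) ∈ W} ≠ 0} *
      ∫⁻ x, ∫⁻ y, μ {p | (p, x) ∈ W ∧ (p, y) ∈ W} ∂ν ∂ν := by
  set f : P → ENNReal := fun p => ν {x | (p, x) ∈ W} with hf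
  have hfm : Measurable f := measurable_measure_prodMk_left hW
  set Z : Set P := {p | f p ≠ 0} with hZ
  have hZm : MeasurableSet Z := (hfm (measurableSet_singleton 0)).compl
  have h1 := ENNReal.lintegral_mul_le_Lp_mul_Lq μ Real.HolderConjugate.two_two hfm.aemeasurable
    (measurable_one.indicator hZm : Measurable (Z.indicator (1 : P → ENNReal))).aemeasurable
  have h2 : f * Z.indicator 1 = f := by
    funext p
    by_cases hp : p ∈ Z
    · simp [hp]
    · have : f p = 0 := not_not.1 hp
      simp [this]
  have h3 : ∫⁻ p, Z.indicator (1 : P → ENNReal) p ^ (2 : ℝ) ∂μ = μ Z := by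
    rw [← lintegral_indicator_one hZm]
    refine lintegral_congr fun p => ?_
    by_cases hp : p ∈ Z <;> simp [hp]
  have h4 : ∫⁻ p, f p ^ (2 : ℝ) ∂μ = ∫⁻ x, ∫⁻ y, μ {p | (p, x) ∈ W ∧ (p, y) ∈ W} ∂ν ∂ν := by
    -- `f(p)²` is the `ν × ν`-measure of the slice over `p` of the set of triples `(p, x, y)`
    set W' : Set (P × (X × X)) := {q | (q.1, q.2.1) ∈ W ∧ (q.1, q.2.2) ∈ W} with hW'
    have hW'm : MeasurableSet W' := by
      refine MeasurableSet.inter ?_ ?_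
      · exact (measurable_fst.prodMk measurable_snd.fst) hW
      · exact (measurable_fst.prodMk measurable_snd.snd) hW
    have h5 : ∀ p, f p ^ (2 : ℝ) = (ν.prod ν) (Prod.mk p ⁻¹' W') := by
      intro p
      rw [ENNReal.rpow_two, sq, ← Measure.prod_prod]
      rfl
    simp_rw [h5]
    rw [← Measure.prod_apply hW'm, Measure.prod_apply_symm hW'm, lintegral_prod]
    · rfl
    · exact (measurable_measure_prodMk_right hW'm).aemeasurable
  rw [h2, h3, h4] at h1
  calc (∫⁻ p, f p ∂μ) ^ 2 ≤ _ := pow_le_pow_left' h1 2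
    _ = _ := by
      rw [mul_pow, ← ENNReal.rpow_natCast, ← ENNReal.rpow_natCast, ← ENNReal.rpow_mul,
        ← ENNReal.rpow_mul]
      norm_num
      exact mul_comm _ _

section Energy

variable {m : ℕ}

local notation "𝕍" => EuclideanSpace ℝ (Fin (m + 1))

theorem measurable_radialProj {n : ℕ} :
    Measurable fun z : EuclideanSpace ℝ (Fin n) × EuclideanSpace ℝ (Fin n) =>
      radialProj z.1 z.2 := by
  unfold radialProj
  fun_prop

theorem measurable_radialProj_left {n : ℕ} (x : EuclideanSpace ℝ (Fin n)) :
    Measurable fun a : EuclideanSpace ℝ (Fin n) => radialProj a x := by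
  unfold radialProj
  fun_prop

theorem norm_radialProj {n : ℕ} {a x : EuclideanSpace ℝ (Fin n)} (h : x ≠ a) :
    ‖radialProj a x‖ = 1 := by
  rw [radialProj, norm_smul, norm_inv, norm_norm,
    inv_mul_cancel₀ (norm_ne_zero_iff.2 (sub_ne_zero.2 h))]

/-- Dyadic form of the bound `min(1, (t / |x - y|)ᵐ)` that transversality gives for the measure of
`{a : |P_a x - P_a y| ≤ 2t}`; it remains valid for `x = y`. -/
theorem measure_radialProj_close_le_sum {F : Set 𝕍} {α : Measure 𝕍} [IsFiniteMeasure α] {C : ℝ}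
    (hC : 0 ≤ C)
    (hα : ∀ x ∈ F, ∀ y ∈ F, x ≠ y → ∀ δ : ℝ, 0 < δ →
      α {a | ‖radialProj a x - radialProj a y‖ ≤ δ * ‖x - y‖} ≤ ENNReal.ofReal (C * δ ^ m))
    {x y : 𝕍} (hx : x ∈ F) (hy : y ∈ F) {t : ℝ} (ht : 0 < t) {K : ℕ}
    (hK : ‖x - y‖ < 2 ^ K * t) :
    α {a | ‖radialProj a x - radialProj a y‖ ≤ 2 * t} ≤
      ∑ k ∈ Finset.range (K + 1), (Metric.ball x (2 ^ k * t)).indicator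
        (fun _ => ENNReal.ofReal (((α univ).toReal + C * 4 ^ m) * ((1 / 2) ^ m) ^ k)) y := by
  -- the single term at the first scale `2ᵏ t` exceeding `|x - y|` already suffices
  classical
  have hex : ∃ k : ℕ, ‖x - y‖ < 2 ^ k * t := ⟨K, hK⟩
  set k := Nat.find hex with hk
  have hkt : ‖x - y‖ < 2 ^ k * t := Nat.find_spec hex
  have hkK : k ≤ K := Nat.find_min' hex hK
  have hα0 : 0 ≤ (α univ).toReal := ENNReal.toReal_nonneg
  have hyk : y ∈ Metric.ball x (2 ^ k * t) := by
    rwa [Metric.mem_ball, dist_comm, dist_eq_norm]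
  refine le_trans ?_ (Finset.single_le_sum (f := fun k => (Metric.ball x (2 ^ k * t)).indicator
        (fun _ => ENNReal.ofReal (((α univ).toReal + C * 4 ^ m) * ((1 / 2) ^ m) ^ k)) y)
    (fun _ _ => zero_le) (Finset.mem_range.2 (Nat.lt_succ_of_le hkK)))
  simp only [indicator_of_mem hyk]
  rcases Nat.eq_zero_or_pos k with h0 | h0
  · rw [h0, pow_zero, mul_one]
    calc α _ ≤ α univ := measure_mono (subset_univ _)
      _ = ENNReal.ofReal (α univ).toReal := (ENNReal.ofReal_toReal (measure_ne_top _ _)).symm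
      _ ≤ _ := ENNReal.ofReal_le_ofReal (by have : 0 ≤ C * 4 ^ m := by positivity
                                            linarith)
  · obtain ⟨l, hl⟩ : ∃ l, k = l + 1 := ⟨k - 1, by omega⟩
    have hlt : 2 ^ l * t ≤ ‖x - y‖ := not_lt.1 (Nat.find_min hex (show l < k by omega))
    have hd : 0 < ‖x - y‖ := lt_of_lt_of_le (by positivity) hlt
    have hxy : x ≠ y := sub_ne_zero.1 (norm_pos_iff.1 hd)
    have h1 := hα x hx y hy hxy (2 * t / ‖x - y‖) (by positivity)
    rw [div_mul_cancel₀ _ hd.ne'] at h1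
    refine h1.trans (ENNReal.ofReal_le_ofReal ?_)
    have h2 : 2 * t / ‖x - y‖ ≤ 4 * (1 / 2) ^ k := by
      rw [div_le_iff₀ hd, hl]
      have h3 : (1 / 2 : ℝ) ^ (l + 1) * (2 ^ l * t) = t / 2 := by
        rw [pow_succ, ← mul_assoc, mul_right_comm ((1 / 2 : ℝ) ^ l), ← mul_pow]
        norm_num
        ring
      have h4 := mul_le_mul_of_nonneg_left hlt (show (0 : ℝ) ≤ (1 / 2) ^ (l + 1) by positivity)
      linarith
    calc C * (2 * t / ‖x - y‖) ^ m ≤ C * (4 * (1 / 2) ^ k) ^ m := by gcongr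
      _ = C * 4 ^ m * ((1 / 2) ^ m) ^ k := by
          rw [mul_pow, ← pow_mul, ← pow_mul, mul_comm k m]; ring
      _ ≤ _ := by
          gcongr
          linarith

/-- One-point energy estimate: integrating the dyadic bound against a measure whose balls at `x`
satisfy `ν (B(x, δ)) ≤ C' δˢ`. -/
theorem lintegral_measure_radialProj_close_le {F : Set 𝕍} {α ν : Measure 𝕍} [IsFiniteMeasure α]
    {C C' D s : ℝ} (hC : 0 ≤ C)
    (hα : ∀ x ∈ F, ∀ y ∈ F, x ≠ y → ∀ δ : ℝ, 0 < δ →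
      α {a | ‖radialProj a x - radialProj a y‖ ≤ δ * ‖x - y‖} ≤ ENNReal.ofReal (C * δ ^ m))
    (hνF : ∀ᵐ x ∂ν, x ∈ F) (hF : ∀ x ∈ F, ∀ y ∈ F, ‖x - y‖ ≤ D) {x : 𝕍} (hx : x ∈ F)
    (hν : ∀ δ : ℝ, 0 < δ → ν (Metric.ball x δ) ≤ ENNReal.ofReal (C' * δ ^ s))
    {t : ℝ} (ht : 0 < t) {K : ℕ} (hK : D < 2 ^ K * t) :
    ∫⁻ y, α {a | ‖radialProj a x - radialProj a y‖ ≤ 2 * t} ∂ν ≤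
      ∑ k ∈ Finset.range (K + 1), ENNReal.ofReal (((α univ).toReal + C * 4 ^ m) * C' *
        (t ^ s * (2 ^ (s - m)) ^ k)) := by
  have hα0 : 0 ≤ (α univ).toReal := ENNReal.toReal_nonneg
  calc ∫⁻ y, α {a | ‖radialProj a x - radialProj a y‖ ≤ 2 * t} ∂ν
      ≤ ∫⁻ y, ∑ k ∈ Finset.range (K + 1), (Metric.ball x (2 ^ k * t)).indicator
        (fun _ => ENNReal.ofReal (((α univ).toReal + C * 4 ^ m) * ((1 / 2) ^ m) ^ k)) y ∂ν := by
        refine lintegral_mono_ae ?_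
        filter_upwards [hνF] with y hy
        exact measure_radialProj_close_le_sum hC hα hx hy ht
          ((hF x hx y hy).trans_lt hK)
    _ = ∑ k ∈ Finset.range (K + 1),
        ENNReal.ofReal (((α univ).toReal + C * 4 ^ m) * ((1 / 2) ^ m) ^ k) *
          ν (Metric.ball x (2 ^ k * t)) := by
        rw [lintegral_finsetSum _ fun k _ => measurable_const.indicator measurableSet_ball]
        refine Finset.sum_congr rfl fun k _ => ?_
        rw [lintegral_indicator_const measurableSet_ball]
    _ ≤ _ := by
        refine Finset.sum_le_sum fun k _ => ?_
        calc _ ≤ ENNReal.ofReal (((α univ).toReal + C * 4 ^ m) * ((1 / 2) ^ m) ^ k) *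
              ENNReal.ofReal (C' * (2 ^ k * t) ^ s) := by
              gcongr
              exact hν _ (by positivity)
          _ = _ := by
              rw [← ENNReal.ofReal_mul (by positivity)]
              congr 1
              have h1 : ((2 : ℝ) ^ (s - m)) ^ k = ((1 / 2) ^ m) ^ k * ((2 : ℝ) ^ k) ^ s := by
                rw [Real.rpow_sub (by norm_num), Real.rpow_natCast, div_pow, ← Real.rpow_natCast,
                  ← Real.rpow_mul (by norm_num), mul_comm s, Real.rpow_mul (by norm_num),
                  Real.rpow_natCast, one_div, inv_pow, inv_pow]
                ring
              rw [h1, Real.mul_rpow (by positivity) ht.le]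
              ring

theorem measure_slice_pair_le {σ : Measure 𝕍} {t : ℝ} {c : ENNReal} {a x y : 𝕍}
    (hσ : σ (Metric.closedBall (radialProj a x) t) ≤ c) :
    σ {θ | ‖radialProj a x - θ‖ ≤ t ∧ ‖radialProj a y - θ‖ ≤ t} ≤
      {a : 𝕍 | ‖radialProj a x - radialProj a y‖ ≤ 2 * t}.indicator (fun _ => c) a := by
  by_cases h : ‖radialProj a x - radialProj a y‖ ≤ 2 * t
  · rw [indicator_of_mem (by exact h)]
    refine le_trans (measure_mono ?_) hσ
    intro θ hθ
    rw [Metric.mem_closedBall, dist_comm, dist_eq_norm]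
    exact hθ.1
  · have hempty : {θ | ‖radialProj a x - θ‖ ≤ t ∧ ‖radialProj a y - θ‖ ≤ t} = ∅ := by
      refine eq_empty_of_forall_notMem fun θ hθ => h ?_
      have h1 := norm_sub_le (radialProj a x - θ) (radialProj a y - θ)
      rw [sub_sub_sub_cancel_right] at h1
      have h2 : ‖radialProj a x - θ‖ ≤ t := hθ.1
      have h3 : ‖radialProj a y - θ‖ ≤ t := hθ.2
      linarith
    rw [hempty, measure_empty]
    exact zero_le

theorem measure_prod_slice_pair_le {α σ : Measure 𝕍} [SFinite α] [SFinite σ] {b t : ℝ}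
    {x y : 𝕍} (hx : ∀ᵐ a ∂α, x ≠ a)
    (hσ : ∀ θ : 𝕍, ‖θ‖ = 1 → σ (Metric.closedBall θ t) ≤ ENNReal.ofReal (b * t ^ m)) :
    (α.prod σ) {p | ‖radialProj p.1 x - p.2‖ ≤ t ∧ ‖radialProj p.1 y - p.2‖ ≤ t} ≤
      ENNReal.ofReal (b * t ^ m) * α {a | ‖radialProj a x - radialProj a y‖ ≤ 2 * t} := by
  have hm : ∀ z : 𝕍, MeasurableSet {p : 𝕍 × 𝕍 | ‖radialProj p.1 z - p.2‖ ≤ t} := fun z =>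
    measurableSet_le (((measurable_radialProj_left z).comp measurable_fst).sub
      measurable_snd).norm measurable_const
  have hQ : MeasurableSet {a : 𝕍 | ‖radialProj a x - radialProj a y‖ ≤ 2 * t} :=
    measurableSet_le ((measurable_radialProj_left x).sub
      (measurable_radialProj_left y)).norm measurable_const
  have hmxy : MeasurableSet
      {p : 𝕍 × 𝕍 | ‖radialProj p.1 x - p.2‖ ≤ t ∧ ‖radialProj p.1 y - p.2‖ ≤ t} :=
    (hm x).inter (hm y)
  rw [Measure.prod_apply hmxy, ← lintegral_indicator_const hQ]
  refine lintegral_mono_ae ?_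
  filter_upwards [hx] with a ha
  exact measure_slice_pair_le (hσ _ (norm_radialProj ha))

theorem le_lintegral_measure_slice {α σ ν : Measure 𝕍} [IsFiniteMeasure α] [IsFiniteMeasure σ]
    [IsFiniteMeasure ν] {b t : ℝ} (hx : ∀ᵐ x ∂ν, ∀ᵐ a ∂α, x ≠ a)
    (hσ : ∀ θ : 𝕍, ‖θ‖ = 1 → ENNReal.ofReal (b * t ^ m) ≤ σ (Metric.closedBall θ t)) :
    ENNReal.ofReal (b * t ^ m) * α univ * ν univ ≤
      ∫⁻ p : 𝕍 × 𝕍, ν {x | ‖radialProj p.1 x - p.2‖ ≤ t} ∂(α.prod σ) := by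
  have hW : MeasurableSet {q : (𝕍 × 𝕍) × 𝕍 | ‖radialProj q.1.1 q.2 - q.1.2‖ ≤ t} :=
    measurableSet_le ((measurable_radialProj.comp
      (measurable_fst.fst.prodMk measurable_snd)).sub measurable_fst.snd).norm measurable_const
  have h1 := Measure.prod_apply (μ := α.prod σ) (ν := ν) hW
  change _ = ∫⁻ p : 𝕍 × 𝕍, ν {x | ‖radialProj p.1 x - p.2‖ ≤ t} ∂(α.prod σ) at h1
  rw [← h1, Measure.prod_apply_symm hW, ← lintegral_const]
  refine lintegral_mono_ae ?_
  filter_upwards [hx] with x hx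
  have hWx : MeasurableSet ((fun p => (p, x)) ⁻¹'
      {q : (𝕍 × 𝕍) × 𝕍 | ‖radialProj q.1.1 q.2 - q.1.2‖ ≤ t}) :=
    (measurable_id.prodMk measurable_const) hW
  rw [Measure.prod_apply hWx, ← lintegral_const]
  refine lintegral_mono_ae ?_
  filter_upwards [hx] with a ha
  refine (hσ _ (norm_radialProj ha)).trans (measure_mono fun θ hθ => ?_)
  rw [Metric.mem_closedBall, dist_comm, dist_eq_norm] at hθ
  exact hθ

/-- Lower bound for the set of pairs (viewpoint, direction) in which the `t`-fattened projection of
`ν` is seen, in terms of a partial sum of the geometric series of ratio `2^(s - m)`. -/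
theorem exists_le_measure_prod_slice_ne_zero {F : Set 𝕍} {α σ ν : Measure 𝕍} [IsFiniteMeasure α]
    [IsFiniteMeasure σ] [IsFiniteMeasure ν] (hα0 : α ≠ 0) (hν0 : ν ≠ 0) {b₁ b₂ C C' D s : ℝ}
    (hb₁ : 0 < b₁) (hb₂ : 0 < b₂) (hC : 0 < C) (hC' : 0 < C')
    (hσ₁ : ∀ θ : 𝕍, ‖θ‖ = 1 → ∀ t : ℝ, 0 < t → t ≤ 1 / 2 →
      ENNReal.ofReal (b₁ * t ^ m) ≤ σ (Metric.closedBall θ t))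
    (hσ₂ : ∀ θ : 𝕍, ‖θ‖ = 1 → ∀ t : ℝ, 0 < t → t ≤ 1 / 2 →
      σ (Metric.closedBall θ t) ≤ ENNReal.ofReal (b₂ * t ^ m))
    (hα : ∀ x ∈ F, ∀ y ∈ F, x ≠ y → ∀ δ : ℝ, 0 < δ →
      α {a | ‖radialProj a x - radialProj a y‖ ≤ δ * ‖x - y‖} ≤ ENNReal.ofReal (C * δ ^ m))
    (hne : ∀ x ∈ F, ∀ᵐ a ∂α, x ≠ a)
    (hF : ∀ x ∈ F, ∀ y ∈ F, ‖x - y‖ ≤ D) (hνF : ∀ᵐ x ∂ν, x ∈ F)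
    (hν : ∀ᵐ x ∂ν, ∀ δ : ℝ, 0 < δ → ν (Metric.ball x δ) ≤ ENNReal.ofReal (C' * δ ^ s)) :
    ∃ c : ℝ, 0 < c ∧ ∀ t : ℝ, 0 < t → t ≤ 1 / 2 → ∀ K : ℕ, D < 2 ^ K * t →
      ENNReal.ofReal (c * t ^ ((m : ℝ) - s) / ∑ k ∈ Finset.range (K + 1), (2 ^ (s - m)) ^ k) ≤
        (α.prod σ) {p | ν {x | ‖radialProj p.1 x - p.2‖ ≤ t} ≠ 0} := by
  set a₀ := (α univ).toReal with ha₀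
  set n₀ := (ν univ).toReal with hn₀
  have ha₀pos : 0 < a₀ := ENNReal.toReal_pos (by simpa using hα0) (measure_ne_top _ _)
  have hn₀pos : 0 < n₀ := ENNReal.toReal_pos (by simpa using hν0) (measure_ne_top _ _)
  have ha₀' : α univ = ENNReal.ofReal a₀ := (ENNReal.ofReal_toReal (measure_ne_top _ _)).symm
  have hn₀' : ν univ = ENNReal.ofReal n₀ := (ENNReal.ofReal_toReal (measure_ne_top _ _)).symm
  set M : ℝ := (a₀ + C * 4 ^ m) * C' with hM
  have hMpos : 0 < M := by positivity
  refine ⟨(b₁ * a₀ * n₀) ^ 2 / (b₂ * M * n₀), by positivity, fun t ht ht2 K hK => ?_⟩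
  set S : ℝ := ∑ k ∈ Finset.range (K + 1), ((2 : ℝ) ^ (s - m)) ^ k with hS
  have hSpos : 0 < S := Finset.sum_pos (fun k _ => by positivity) ⟨0, by simp⟩
  have hW : MeasurableSet {q : (𝕍 × 𝕍) × 𝕍 | ‖radialProj q.1.1 q.2 - q.1.2‖ ≤ t} :=
    measurableSet_le ((measurable_radialProj.comp
      (measurable_fst.fst.prodMk measurable_snd)).sub measurable_fst.snd).norm measurable_const
  have hCS := sq_lintegral_measure_slice_le (μ := α.prod σ) (ν := ν) hW
  simp only [mem_ofPred_eq] at hCS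
  have hlow : ENNReal.ofReal (b₁ * t ^ m * a₀ * n₀) ≤
      ∫⁻ p : 𝕍 × 𝕍, ν {x | ‖radialProj p.1 x - p.2‖ ≤ t} ∂(α.prod σ) := by
    refine le_trans (le_of_eq ?_) (le_lintegral_measure_slice (hνF.mono hne)
      fun θ hθ => hσ₁ θ hθ t ht ht2)
    rw [ha₀', hn₀', ← ENNReal.ofReal_mul (by positivity), ← ENNReal.ofReal_mul (by positivity)]
  have hup : ∫⁻ x, ∫⁻ y, (α.prod σ) {p | ‖radialProj p.1 x - p.2‖ ≤ t ∧
      ‖radialProj p.1 y - p.2‖ ≤ t} ∂ν ∂ν ≤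
      ENNReal.ofReal (b₂ * t ^ m * (M * t ^ s * S) * n₀) := by
    have hMt : 0 ≤ M * t ^ s * S := mul_nonneg (mul_nonneg hMpos.le (by positivity)) hSpos.le
    have hbt : 0 ≤ b₂ * t ^ m := by positivity
    calc _ ≤ ∫⁻ _x, ENNReal.ofReal (b₂ * t ^ m * (M * t ^ s * S)) ∂ν := by
          refine lintegral_mono_ae ?_
          filter_upwards [hνF, hν] with x hx hνx
          calc _ ≤ ∫⁻ y, ENNReal.ofReal (b₂ * t ^ m) *
                α {a | ‖radialProj a x - radialProj a y‖ ≤ 2 * t} ∂ν :=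
                lintegral_mono fun y => measure_prod_slice_pair_le (hne x hx)
                  fun θ hθ => hσ₂ θ hθ t ht ht2
            _ = ENNReal.ofReal (b₂ * t ^ m) *
                ∫⁻ y, α {a | ‖radialProj a x - radialProj a y‖ ≤ 2 * t} ∂ν :=
                lintegral_const_mul' _ _ ENNReal.ofReal_ne_top
            _ ≤ ENNReal.ofReal (b₂ * t ^ m) * ENNReal.ofReal (M * t ^ s * S) := by
                gcongr
                refine (lintegral_measure_radialProj_close_le hC.le hα hνF hF hx hνx ht
                  hK).trans_eq ?_
                rw [← ENNReal.ofReal_sum_of_nonneg fun k _ => by positivity, ← Finset.mul_sum,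
                  ← Finset.mul_sum, mul_assoc M]
            _ = _ := (ENNReal.ofReal_mul hbt).symm
      _ = _ := by
          rw [lintegral_const, hn₀', ← ENNReal.ofReal_mul (mul_nonneg hbt hMt)]
  set Z := (α.prod σ) {p | ν {x | ‖radialProj p.1 x - p.2‖ ≤ t} ≠ 0} with hZ
  have hfin : ENNReal.ofReal ((b₁ * t ^ m * a₀ * n₀) ^ 2) ≤
      Z * ENNReal.ofReal (b₂ * t ^ m * (M * t ^ s * S) * n₀) := by
    rw [ENNReal.ofReal_pow (by positivity)]
    exact (pow_le_pow_left' hlow 2).trans (hCS.trans (by gcongr))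
  have hpos : 0 < b₂ * t ^ m * (M * t ^ s * S) * n₀ :=
    mul_pos (mul_pos (by positivity) (mul_pos (mul_pos hMpos (by positivity)) hSpos)) hn₀pos
  have hdiv := ENNReal.div_le_of_le_mul hfin
  rw [← ENNReal.ofReal_div_of_pos hpos] at hdiv
  refine le_trans (le_of_eq ?_) hdiv
  congr 1
  rw [Real.rpow_sub ht, Real.rpow_natCast]
  have : 0 < t ^ s := by positivity
  field_simp

end Energy

/-! ### Surfaces and visibility -/

section Surface

variable {n m : ℕ} {A E F : Set (EuclideanSpace ℝ (Fin n))}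

theorem IsPiecewiseSmoothSurface.isCompact (hA : IsPiecewiseSmoothSurface m A) : IsCompact A := by
  obtain ⟨k, S, hS, rfl⟩ := hA
  refine isCompact_iUnion fun i => ?_
  obtain ⟨D, U, φ, -, hD, -, -, hDU, hφ, -, -, hSi⟩ := hS i
  rw [← hSi]
  exact hD.image_of_continuousOn (hφ.continuousOn.mono hDU)

theorem IsPiecewiseSmoothSurface.hausdorffMeasure_lt_top (hm : 1 ≤ m)
    (hA : IsPiecewiseSmoothSurface m A) : μH[m] A < ⊤ := by
  obtain ⟨k, S, hS, rfl⟩ := hA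
  refine (measure_iUnion_le S).trans_lt ?_
  rw [tsum_fintype]
  refine ENNReal.sum_lt_top.2 fun i _ => ?_
  obtain ⟨D, U, φ, -, hD, -, hU, hDU, hφ, -, -, hSi⟩ := hS i
  rw [← hSi]
  exact hausdorffMeasure_image_lt_top hm hD hU hDU hφ

theorem IsPiecewiseSmoothSurface.hausdorffMeasure_pos (hm : 1 ≤ m)
    (hA : IsPiecewiseSmoothSurface m A) (hne : A.Nonempty) : 0 < μH[m] A := by
  obtain ⟨k, S, hS, rfl⟩ := hA
  obtain ⟨i, -⟩ := nonempty_iUnion.1 hne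
  obtain ⟨D, U, φ, hDne, hD, hcl, hU, hDU, hφ, -, hinj, hSi⟩ := hS i
  obtain ⟨u, hu⟩ : (interior D).Nonempty := by
    rw [← closure_nonempty_iff, hcl]
    exact hDne
  obtain ⟨B, hBD, -, hpos⟩ := exists_nhds_hausdorffMeasure_image_pos hm
    ((hφ.contDiffAt (hU.mem_nhds (hDU (interior_subset hu)))).hasStrictFDerivAt one_ne_zero)
    (hinj u (interior_subset hu)) (mem_interior_iff_mem_nhds.1 hu)
  refine hpos.trans_le (measure_mono ((image_mono hBD).trans ?_))
  rw [hSi]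
  exact subset_iUnion S i

theorem IsPiecewiseSmoothSurface.le_norm_sub (hm : 1 ≤ m)
    (hA : IsPiecewiseSmoothSurface m A) {ρ : ℝ}
    (htan : ∀ᵐ a ∂((μH[m]).restrict A), ∀ p ∈ tangentPlaneAt A a, ∀ e ∈ E, ρ ≤ dist p e) :
    ∀ a ∈ A, ∀ e ∈ closure E, ρ ≤ ‖e - a‖ := by
  obtain ⟨k, S, hS, rfl⟩ := hA
  intro a ha e he
  obtain ⟨i, hi⟩ := mem_iUnion.1 ha
  obtain ⟨D, U, φ, -, hD, hcl, hU, hDU, hφ, -, hinj, hSi⟩ := hS i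
  rw [← hSi] at hi
  obtain ⟨u, hu, rfl⟩ := hi
  have h := le_norm_sub_of_ae_tangentPlaneAt hm hcl hU hDU hφ hinj
    (by rw [hSi]; exact subset_iUnion S i) htan u hu e he 0
  simpa using h

theorem IsPiecewiseSmoothSurface.hasTransversalityBound (hm : 1 ≤ m)
    (hA : IsPiecewiseSmoothSurface m A) {R ρ : ℝ} (hR : 0 ≤ R) (hρ : 0 < ρ)
    (hbdd : ∀ a ∈ A, ∀ e ∈ closure E, ‖e - a‖ ≤ R)
    (htan : ∀ᵐ a ∂((μH[m]).restrict A), ∀ p ∈ tangentPlaneAt A a, ∀ e ∈ E, ρ ≤ dist p e) :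
    HasTransversalityBound m (closure E) A := by
  obtain ⟨k, S, hS, hAS⟩ := hA
  have hSA : ∀ i, S i ⊆ A := fun i => hAS ▸ subset_iUnion S i
  have hpatch : ∀ i, HasTransversalityBound m (closure E) (S i) := by
    intro i
    obtain ⟨D, U, φ, -, hD, hcl, hU, hDU, hφ, -, hinj, hSi⟩ := hS i
    rw [← hSi]
    refine hasTransversalityBound_image hm hD hU hDU hφ hinj hR hρ
      (fun u hu e he => hbdd _ (hSA i (hSi ▸ mem_image_of_mem φ hu)) e he) ?_
    exact le_norm_sub_of_ae_tangentPlaneAt hm hcl hU hDU hφ hinj (hSi ▸ hSA i) htan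
  have hfin : ∀ t : Finset (Fin k), HasTransversalityBound m (closure E) (⋃ i ∈ t, S i) := by
    classical
    intro t
    induction t using Finset.induction_on with
    | empty => simpa using HasTransversalityBound.empty (m := m) (closure E)
    | insert i t _ ih =>
      rw [Finset.set_biUnion_insert]
      exact (hpatch i).union ih
  have h := hfin Finset.univ
  rw [hAS]
  simpa using h

/-- For `δ` above the threshold the total measure of `A` serves as the bound. -/
theorem HasTransversalityBound.exists_forall_pos (h : HasTransversalityBound m F A)
    (hfin : μH[m] A < ⊤) : ∃ C : ℝ, 0 < C ∧ ∀ x ∈ F, ∀ y ∈ F, x ≠ y → ∀ δ : ℝ, 0 < δ →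
      μH[m] {a | a ∈ A ∧ ‖radialProj a x - radialProj a y‖ ≤ δ * ‖x - y‖} ≤
        ENNReal.ofReal (C * δ ^ m) := by
  obtain ⟨C, δ₁, hC, hδ₁, h⟩ := h
  have hA0 : 0 ≤ (μH[m] A).toReal := ENNReal.toReal_nonneg
  refine ⟨C + (μH[m] A).toReal / δ₁ ^ m, by positivity, fun x hx y hy hxy δ hδ => ?_⟩
  rcases le_or_gt δ δ₁ with hle | hlt
  · refine (h x hx y hy hxy δ hδ hle).trans (ENNReal.ofReal_le_ofReal ?_)
    gcongr
    have : 0 ≤ (μH[m] A).toReal / δ₁ ^ m := by positivity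
    linarith
  · calc μH[m] {a | a ∈ A ∧ ‖radialProj a x - radialProj a y‖ ≤ δ * ‖x - y‖}
        ≤ μH[m] A := measure_mono fun a ha => ha.1
      _ = ENNReal.ofReal (μH[m] A).toReal := (ENNReal.ofReal_toReal hfin.ne).symm
      _ ≤ _ := by
        apply ENNReal.ofReal_le_ofReal
        have h1 : (μH[m] A).toReal = (μH[m] A).toReal / δ₁ ^ m * δ₁ ^ m := by field_simp
        have h2 : (μH[m] A).toReal / δ₁ ^ m * δ₁ ^ m ≤ (μH[m] A).toReal / δ₁ ^ m * δ ^ m := by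
          gcongr
        have h3 : 0 ≤ C * δ ^ m := by positivity
        linarith

end Surface

section Visibility

variable {m : ℕ}

local notation "𝕍" => EuclideanSpace ℝ (Fin (m + 1))

theorem isTransversal_radialProj (hm : 1 ≤ m) {E A : Set 𝕍} (hA : IsCompact A)
    (hpos : 0 < μH[m] A) (hfin : μH[m] A < ⊤) (hne : ∀ a ∈ A, ∀ e ∈ E, e ≠ a) {C : ℝ} (hC : 0 < C)
    (hbound : ∀ x ∈ E, ∀ y ∈ E, x ≠ y → ∀ δ : ℝ, 0 < δ →
      μH[m] {a | a ∈ A ∧ ‖radialProj a x - radialProj a y‖ ≤ δ * ‖x - y‖} ≤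
        ENNReal.ofReal (C * δ ^ m)) :
    IsTransversal (m : ℝ) m E (Metric.sphere (0 : 𝕍) 1)
      ((μH[m]).restrict (Metric.sphere (0 : 𝕍) 1)) A
      ((μH[m] A)⁻¹ • (μH[m]).restrict A) radialProj := by
  refine ⟨⟨hm, Nat.lt_succ_self m, ?_, ?_, ?_, ⟨A, hA, Subset.rfl, ?_⟩, ?_, ?_⟩, ?_⟩
  · rw [Measure.restrict_apply Metric.isClosed_sphere.measurableSet.compl]
    simp
  · obtain ⟨c, hc, h⟩ := exists_le_hausdorffMeasure_cap (m := m) hm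
    refine ⟨c, hc, fun x hx δ hδ hδ1 => ?_⟩
    rw [Measure.restrict_apply (measurableSet_ball.inter Metric.isClosed_sphere.measurableSet),
      inter_assoc, inter_self]
    exact h x (mem_sphere_zero_iff_norm.1 hx) δ hδ hδ1
  · constructor
    rw [Measure.smul_apply, Measure.restrict_apply_univ, smul_eq_mul,
      ENNReal.inv_mul_cancel hpos.ne' hfin.ne]
  · rw [Measure.smul_apply, Measure.restrict_apply hA.measurableSet.compl]
    simp
  · intro a ha x hx
    exact mem_sphere_zero_iff_norm.2 (norm_radialProj (hne a ha x hx))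
  · unfold radialProj
    have hsub : Continuous fun z : 𝕍 × 𝕍 => z.1 - z.2 := by fun_prop
    refine (hsub.norm.continuousOn.inv₀ ?_).smul hsub.continuousOn
    rintro ⟨x, a⟩ ⟨hx, ha⟩
    exact norm_ne_zero_iff.2 (sub_ne_zero.2 (hne a ha x hx))
  · have hA0 : 0 < (μH[m] A).toReal := ENNReal.toReal_pos hpos.ne' hfin.ne
    refine ⟨(μH[m] A).toReal⁻¹ * C + 1, 1, by positivity, one_pos,
      fun x hx y hy hxy δ hδ _ => ?_⟩
    rw [sub_self, Real.rpow_zero, mul_one, Measure.smul_apply, smul_eq_mul]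
    have h1 : (μH[m]).restrict A {a | a ∈ A ∧ ‖radialProj a x - radialProj a y‖ ≤ δ * ‖x - y‖} ≤
        ENNReal.ofReal (C * δ ^ m) :=
      (Measure.restrict_apply_le _ _).trans (hbound x hx y hy hxy δ hδ)
    calc _ ≤ (μH[m] A)⁻¹ * ENNReal.ofReal (C * δ ^ m) := by gcongr
      _ = ENNReal.ofReal ((μH[m] A).toReal⁻¹ * C * δ ^ m) := by
          rw [← ENNReal.ofReal_toReal hfin.ne, ← ENNReal.ofReal_inv_of_pos hA0,
            ← ENNReal.ofReal_mul (by positivity), mul_assoc, ENNReal.toReal_ofReal hA0.le]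
      _ < _ := by
          rw [ENNReal.ofReal_lt_ofReal_iff (by positivity), add_mul]
          have : 0 < δ ^ m := by positivity
          linarith

/-- The witness for `θ` is the point at distance `|x - a|` from `a` in the direction `θ`. -/
theorem slice_subset_radialProj_image_thickening {E : Set 𝕍} {a θ x : 𝕍} {R r t : ℝ} (hR : 0 ≤ R)
    (hx : x ∈ closure E) (hxa : x ≠ a) (hxR : ‖x - a‖ ≤ R) (ht : R * t < r) (hθ : ‖θ‖ = 1)
    (hclose : ‖radialProj a x - θ‖ ≤ t) :
    θ ∈ radialProj a '' (Metric.thickening r E \ {a}) := by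
  have hd : 0 < ‖x - a‖ := norm_pos_iff.2 (sub_ne_zero.2 hxa)
  have hsub : a + ‖x - a‖ • θ - a = ‖x - a‖ • θ := by abel
  refine ⟨a + ‖x - a‖ • θ, ⟨?_, ?_⟩, ?_⟩
  · rw [← Metric.thickening_closure, Metric.mem_thickening_iff]
    refine ⟨x, hx, ?_⟩
    have h1 : a + ‖x - a‖ • θ - x = -(‖x - a‖ • (radialProj a x - θ)) := by
      rw [radialProj, smul_sub, smul_smul, mul_inv_cancel₀ hd.ne', one_smul]
      abel
    rw [dist_eq_norm, h1, norm_neg, norm_smul, norm_norm]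
    exact lt_of_le_of_lt (mul_le_mul hxR hclose (norm_nonneg _) hR) ht
  · intro h
    have h2 : ‖x - a‖ • θ = 0 := by rw [← hsub, mem_singleton_iff.1 h, sub_self]
    rcases smul_eq_zero.1 h2 with h3 | h3
    · exact hd.ne' h3
    · rw [h3, norm_zero] at hθ
      exact zero_ne_one hθ
  · rw [radialProj, hsub, norm_smul, norm_norm, hθ, mul_one, smul_smul, inv_mul_cancel₀ hd.ne',
      one_smul]

/-- The visibility estimate for all `s` at once; only the size of the geometric sum, in which `2ᴷ r`
has to exceed a multiple of the diameter of `E`, distinguishes `s < m` from `s = m`. -/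
theorem exists_le_lintegral_vis (hm : 1 ≤ m) {s : ℝ} (hs : 0 ≤ s) {E A : Set 𝕍}
    (hE_pos : 0 < μH[s] E) (hE_fin : μH[s] E < ⊤) (hA : IsCompact A)
    (hpos : 0 < μH[m] A) (hfin : μH[m] A < ⊤) {R : ℝ} (hR : 0 ≤ R)
    (hne : ∀ a ∈ A, ∀ e ∈ closure E, e ≠ a) (hbdd : ∀ a ∈ A, ∀ e ∈ closure E, ‖e - a‖ ≤ R)
    {C : ℝ} (hC : 0 < C) (hbound : ∀ x ∈ closure E, ∀ y ∈ closure E, x ≠ y → ∀ δ : ℝ, 0 < δ →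
      μH[m] {a | a ∈ A ∧ ‖radialProj a x - radialProj a y‖ ≤ δ * ‖x - y‖} ≤
        ENNReal.ofReal (C * δ ^ m)) :
    ∃ c : ℝ, 0 < c ∧ ∀ r : ℝ, 0 < r → r < 1 → ∀ K : ℕ, (2 * (R + 1)) ^ 2 < 2 ^ K * r →
      ENNReal.ofReal (c * r ^ ((m : ℝ) - s) / ∑ k ∈ Finset.range (K + 1), (2 ^ (s - m)) ^ k) ≤
        ∫⁻ a in A, vis a (Metric.thickening r E) ∂μH[m] := by
  obtain ⟨C', hC', G, hG, hGpos, hGball⟩ :=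
    exists_measurableSet_hausdorffMeasure_ball_le hs hE_pos hE_fin
  set α : Measure 𝕍 := (μH[m]).restrict A with hαdef
  set σ : Measure 𝕍 := (μH[m]).restrict (Metric.sphere 0 1) with hσdef
  set ν : Measure 𝕍 := ((μH[s]).restrict E).restrict G with hνdef
  have hSm : MeasurableSet (Metric.sphere (0 : 𝕍) 1) := Metric.isClosed_sphere.measurableSet
  have : IsFiniteMeasure α := ⟨by simpa [hαdef] using hfin⟩
  have : IsFiniteMeasure σ := ⟨by simpa [hσdef] using hausdorffMeasure_sphere_lt_top hm⟩
  have : IsFiniteMeasure ((μH[s] : Measure 𝕍).restrict E) := ⟨by simpa using hE_fin⟩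
  have hα0 : α ≠ 0 := by
    intro h
    have : α univ = 0 := by rw [h]; rfl
    rw [hαdef, Measure.restrict_apply_univ] at this
    exact hpos.ne' this
  have hν0 : ν ≠ 0 := by
    intro h
    have : ν univ = 0 := by rw [h]; rfl
    rw [hνdef, Measure.restrict_apply_univ] at this
    exact hGpos.ne' this
  obtain ⟨b₁, hb₁, hcap₁⟩ := exists_le_hausdorffMeasure_cap (m := m) hm
  obtain ⟨b₂, hb₂, hcap₂⟩ := exists_hausdorffMeasure_cap_le (m := m) hm
  have hαA : ∀ᵐ a ∂α, a ∈ A := ae_restrict_mem hA.measurableSet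
  -- `E` need not be measurable, so `ν` is only known to be carried by its closure
  have hνF : ∀ᵐ x ∂ν, x ∈ closure E := by
    refine ae_restrict_of_ae ?_
    rw [ae_iff]
    change (μH[s]).restrict E (closure E)ᶜ = 0
    rw [Measure.restrict_apply isClosed_closure.measurableSet.compl]
    convert measure_empty (μ := (μH[s] : Measure 𝕍))
    exact eq_empty_of_forall_notMem fun x hx => hx.1 (subset_closure hx.2)
  obtain ⟨a₀, ha₀⟩ : A.Nonempty := nonempty_of_measure_ne_zero hpos.ne'
  have hmain := exists_le_measure_prod_slice_ne_zero (F := closure E) (α := α) (σ := σ) (ν := ν)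
    (D := 2 * R) (s := s) hα0 hν0 hb₁ hb₂ hC hC' ?_ ?_ ?_ ?_ ?_ hνF ?_
  · obtain ⟨c, hc, hmain⟩ := hmain
    refine ⟨c * ((2 * (R + 1))⁻¹) ^ ((m : ℝ) - s), by positivity, fun r hr hr1 K hK => ?_⟩
    set t : ℝ := (2 * (R + 1))⁻¹ * r with ht
    have hR1 : 0 < 2 * (R + 1) := by positivity
    have ht0 : 0 < t := by positivity
    have htr : 2 * (R + 1) * t = r := by rw [ht, ← mul_assoc, mul_inv_cancel₀ hR1.ne', one_mul]
    have hRt : R * t < r := by nlinarith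
    have ht2 : t ≤ 1 / 2 := by nlinarith [mul_nonneg hR ht0.le]
    have hKt : 2 * R < 2 ^ K * t := by
      have h1 : 2 * (R + 1) * (2 * (R + 1)) < 2 * (R + 1) * (2 ^ K * t) := by
        calc 2 * (R + 1) * (2 * (R + 1)) = (2 * (R + 1)) ^ 2 := by ring
          _ < 2 ^ K * r := hK
          _ = 2 * (R + 1) * (2 ^ K * t) := by rw [← htr]; ring
      have := lt_of_mul_lt_mul_left h1 hR1.le
      linarith
    have h1 := hmain t ht0 ht2 K hKt
    rw [ht, Real.mul_rpow (by positivity) hr.le, ← mul_assoc, ← ht] at h1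
    refine h1.trans ?_
    have hW : MeasurableSet {q : (𝕍 × 𝕍) × 𝕍 | ‖radialProj q.1.1 q.2 - q.1.2‖ ≤ t} :=
      measurableSet_le ((measurable_radialProj.comp
        (measurable_fst.fst.prodMk measurable_snd)).sub measurable_fst.snd).norm measurable_const
    have hZ : MeasurableSet {p : 𝕍 × 𝕍 | ν {x | ‖radialProj p.1 x - p.2‖ ≤ t} ≠ 0} :=
      ((measurable_measure_prodMk_left (ν := ν) hW) (measurableSet_singleton 0)).compl
    rw [Measure.prod_apply hZ]
    refine lintegral_mono_ae ?_
    filter_upwards [hαA] with a ha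
    rw [hσdef, Measure.restrict_apply (measurable_prodMk_left hZ), vis,
      show ((m + 1 : ℕ) : ℝ) - 1 = m by push_cast; ring]
    refine measure_mono ?_
    rintro θ ⟨hθ, hθ1⟩
    have hθ' : ν {x | ‖radialProj a x - θ‖ ≤ t} ≠ 0 := hθ
    obtain ⟨x, hx, hxF⟩ : ∃ x, ‖radialProj a x - θ‖ ≤ t ∧ x ∈ closure E := by
      by_contra hcon
      push Not at hcon
      exact hθ' (measure_mono_null (fun x hx => hcon x hx) (ae_iff.1 hνF))
    exact slice_subset_radialProj_image_thickening hR hxF (hne a ha x hxF) (hbdd a ha x hxF) hRt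
      (mem_sphere_zero_iff_norm.1 hθ1) hx
  · intro θ hθ t ht ht2
    refine (hcap₁ θ hθ t ht (by linarith)).trans ?_
    rw [hσdef, Measure.restrict_apply Metric.isClosed_closedBall.measurableSet]
    exact measure_mono (inter_subset_inter_left _ Metric.ball_subset_closedBall)
  · intro θ hθ t ht ht2
    rw [hσdef, Measure.restrict_apply Metric.isClosed_closedBall.measurableSet]
    exact hcap₂ θ hθ t ht ht2
  · intro x hx y hy hxy δ hδ
    rw [hαdef, Measure.restrict_apply' hA.measurableSet]
    refine le_trans (measure_mono ?_) (hbound x hx y hy hxy δ hδ)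
    exact fun a ha => ⟨ha.2, ha.1⟩
  · intro x hx
    filter_upwards [hαA] with a ha using hne a ha x hx
  · intro x hx y hy
    have h1 := norm_sub_le (x - a₀) (y - a₀)
    rw [sub_sub_sub_cancel_right] at h1
    have h2 := hbdd a₀ ha₀ x hx
    have h3 := hbdd a₀ ha₀ y hy
    linarith
  · filter_upwards [ae_restrict_mem hG] with x hx δ hδ
    exact (Measure.restrict_apply_le _ _).trans (hGball x hx δ hδ)

end Visibility

/-- Below the critical dimension the geometric series converges. -/
theorem exists_le_rpow_of_forall_geom_sum {g : ℝ → ENNReal} {s d B c : ℝ} (hc : 0 < c)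
    (hsd : s < d) (h : ∀ r : ℝ, 0 < r → r < 1 → ∀ K : ℕ, B < 2 ^ K * r →
      ENNReal.ofReal (c * r ^ (d - s) / ∑ k ∈ Finset.range (K + 1), (2 ^ (s - d)) ^ k) ≤ g r) :
    ∃ c : ℝ, 0 < c ∧ ∀ r : ℝ, 0 < r → r < 1 → ENNReal.ofReal (c * r ^ (d - s)) ≤ g r := by
  have hq0 : (0 : ℝ) < 2 ^ (s - d) := by positivity
  have hq1 : (2 : ℝ) ^ (s - d) < 1 := Real.rpow_lt_one_of_one_lt_of_neg (by norm_num) (by linarith)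
  refine ⟨c * (1 - 2 ^ (s - d)), mul_pos hc (by linarith), fun r hr hr1 => ?_⟩
  obtain ⟨K, hK⟩ := pow_unbounded_of_one_lt (B / r) (one_lt_two : (1 : ℝ) < 2)
  refine le_trans (ENNReal.ofReal_le_ofReal ?_) (h r hr hr1 K ((div_lt_iff₀ hr).1 hK))
  have hSpos : 0 < ∑ k ∈ Finset.range (K + 1), ((2 : ℝ) ^ (s - d)) ^ k :=
    Finset.sum_pos (fun k _ => by positivity) ⟨0, by simp⟩
  rw [le_div_iff₀ hSpos]
  have h1 : (1 - 2 ^ (s - d)) * ∑ k ∈ Finset.range (K + 1), ((2 : ℝ) ^ (s - d)) ^ k ≤ 1 := by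
    have h2 := mul_neg_geom_sum ((2 : ℝ) ^ (s - d)) (K + 1)
    rw [h2]
    have : 0 < ((2 : ℝ) ^ (s - d)) ^ (K + 1) := by positivity
    linarith
  have h3 : 0 ≤ c * r ^ (d - s) := by positivity
  have h4 := mul_le_mul_of_nonneg_left h1 h3
  linarith

/-- In the critical dimension each of the `O(log (1 / r))` dyadic scales contributes equally. -/
theorem exists_le_inv_log_of_forall_geom_sum {g : ℝ → ENNReal} {d B c : ℝ} (hc : 0 < c)
    (h : ∀ r : ℝ, 0 < r → r < 1 → ∀ K : ℕ, B < 2 ^ K * r →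
      ENNReal.ofReal (c * r ^ (d - d) / ∑ k ∈ Finset.range (K + 1), (2 ^ (d - d)) ^ k) ≤ g r) :
    ∃ c : ℝ, 0 < c ∧ ∀ r : ℝ, 0 < r → r ≤ 1 / 2 →
      ENNReal.ofReal (c * (Real.log (1 / r))⁻¹) ≤ g r := by
  obtain ⟨N, hN⟩ := pow_unbounded_of_one_lt B (one_lt_two : (1 : ℝ) < 2)
  have hl2 : 0 < Real.log 2 := Real.log_pos one_lt_two
  refine ⟨c * Real.log 2 / (N + 3), by positivity, fun r hr hr2 => ?_⟩
  obtain ⟨k, hk1, hk2⟩ := exists_nat_pow_near (x := 1 / r) (y := 2)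
    (by rw [le_div_iff₀ hr]; linarith) one_lt_two
  rw [div_lt_iff₀ hr] at hk2
  have hK : B < 2 ^ (N + (k + 1)) * r := by
    rw [pow_add, mul_assoc]
    have h1 : (2 : ℝ) ^ N * 1 < 2 ^ N * (2 ^ (k + 1) * r) := by gcongr
    linarith
  refine le_trans (ENNReal.ofReal_le_ofReal ?_) (h r hr (by linarith) _ hK)
  -- `r ≤ 1 / 2` keeps the logarithm away from zero, which absorbs the additive constant `N + 2`
  have hlog : Real.log 2 ≤ Real.log (1 / r) := by
    apply Real.log_le_log two_pos
    rw [le_div_iff₀ hr]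
    linarith
  have hklog : k * Real.log 2 ≤ Real.log (1 / r) := by
    rw [← Real.log_pow]
    exact Real.log_le_log (by positivity) hk1
  have hL : 0 < Real.log (1 / r) := hl2.trans_le hlog
  simp only [sub_self, Real.rpow_zero, one_pow, Finset.sum_const, Finset.card_range, nsmul_eq_mul,
    mul_one]
  rw [← div_eq_mul_inv, div_div, div_le_div_iff₀ (by positivity) (by positivity), mul_assoc]
  refine mul_le_mul_of_nonneg_left ?_ hc.le
  push_cast
  have h5 := mul_le_mul_of_nonneg_left hlog (show (0 : ℝ) ≤ N + 2 by positivity)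
  linarith

theorem theorem1p7 (n : ℕ) (hn : 2 ≤ n) (s : ℝ) (hs : 0 ≤ s)
    (E A : Set (EuclideanSpace ℝ (Fin n)))
    (hE_pos : 0 < μH[s] E) (hE_fin : μH[s] E < ⊤)
    (hA_ne : A.Nonempty) (hA : IsPiecewiseSmoothSurface (n - 1) A)
    (hbdd : ∃ R : ℝ, ∀ a ∈ A, ∀ e ∈ E, dist a e ≤ R)
    (ρ : ℝ) (hρ : 0 < ρ)
    (htan : ∀ᵐ a ∂((μH[(n : ℝ) - 1]).restrict A),
      ∀ p ∈ tangentPlaneAt A a, ∀ e ∈ E, ρ ≤ dist p e) :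
    IsTransversal ((n : ℝ) - 1) (n - 1) E
      (Metric.sphere (0 : EuclideanSpace ℝ (Fin n)) 1)
      ((μH[(n : ℝ) - 1]).restrict (Metric.sphere (0 : EuclideanSpace ℝ (Fin n)) 1))
      A (normalizedSurfaceMeasure A) radialProj ∧
    (s < (n : ℝ) - 1 → ∃ c : ℝ, 0 < c ∧ ∀ r : ℝ, 0 < r → r < 1 →
      ENNReal.ofReal (c * r ^ ((n : ℝ) - 1 - s)) ≤
        ∫⁻ a in A, vis a (Metric.thickening r E) ∂μH[(n : ℝ) - 1]) ∧
    (s = (n : ℝ) - 1 → ∃ c : ℝ, 0 < c ∧ ∀ r : ℝ, 0 < r → r ≤ 1 / 2 →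
      ENNReal.ofReal (c * (Real.log (1 / r))⁻¹) ≤
        ∫⁻ a in A, vis a (Metric.thickening r E) ∂μH[(n : ℝ) - 1]) := by
  obtain ⟨m, rfl⟩ : ∃ m, n = m + 1 := ⟨n - 1, by omega⟩
  have hm : 1 ≤ m := by omega
  have hdim : ((m + 1 : ℕ) : ℝ) - 1 = m := by push_cast; ring
  unfold normalizedSurfaceMeasure
  simp only [hdim, Nat.add_sub_cancel] at hA htan ⊢
  obtain ⟨R, hR⟩ := hbdd
  have hbdd' : ∀ a ∈ A, ∀ e ∈ closure E, ‖e - a‖ ≤ max R 0 := by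
    intro a ha
    refine closure_minimal (t := {e | ‖e - a‖ ≤ max R 0}) (fun e he => ?_)
      (isClosed_le (by fun_prop) continuous_const)
    change ‖e - a‖ ≤ max R 0
    rw [← dist_eq_norm, dist_comm]
    exact (hR a ha e he).trans (le_max_left _ _)
  have hR0 : 0 ≤ max R 0 := le_max_right _ _
  have hcomp := hA.isCompact
  have hpos := hA.hausdorffMeasure_pos hm hA_ne
  have hfin := hA.hausdorffMeasure_lt_top hm
  have hne : ∀ a ∈ A, ∀ e ∈ closure E, e ≠ a := by
    rintro a ha e he rfl
    have := hA.le_norm_sub hm htan e ha e he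
    rw [sub_self, norm_zero] at this
    linarith
  obtain ⟨C, hC, hbound⟩ :=
    (hA.hasTransversalityBound hm hR0 hρ hbdd' htan).exists_forall_pos hfin
  obtain ⟨c, hc, hvis⟩ :=
    exists_le_lintegral_vis hm hs hE_pos hE_fin hcomp hpos hfin hR0 hne hbdd' hC hbound
  refine ⟨?_, fun hsm => exists_le_rpow_of_forall_geom_sum hc hsm hvis, fun hsm => ?_⟩
  · exact isTransversal_radialProj hm hcomp hpos hfin
      (fun a ha e he => hne a ha e (subset_closure he)) hC
      fun x hx y hy => hbound x (subset_closure hx) y (subset_closure hy)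
  · subst hsm
    exact exists_le_inv_log_of_forall_geom_sum hc hvis
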